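/- Let $n\ge 2$ be an integer and let $A$ be a selfinjective Artin algebra, i.e. $A$ is a finitely generated algebra (as a module) over a commutative Artinian ring and is injective as a left module over itself. Let $A\text{-mod}$ be the category of finitely generated left $A$-modules and $A\text{-}\underline{\mathrm{mod}}$ its stable category modulo projective modules. For a category $\mathcal C$ let $\mathrm{Mor}_n(\mathcal C)$ be the category whose objects are the sequences $X_n\xrightarrow{\phi_{n-1}}X_{n-1}\to\cdots\xrightarrow{\phi_1}X_1$ in $\mathcal C$ and whose morphisms are the commutative ladders. For $X=X_{(\phi_i)}\in\mathrm{Mor}_n(A\text{-mod})$ let $X_{(\underline{\phi_i})}\in\mathrm{Mor}_n(A\text{-}\underline{\mathrm{mod}})$ be its image. The rotation $\mathbf{Rot}\,X_{(\underline{\phi_i})}$ of an object $X_{(\underline{\phi_i})}$ of $\mathrm{Mor}_n(A\text{-}\underline{\mathrm{mod}})$ is defined, up to isomorphism, as follows. Choose representatives $\phi_i$ in $A\text{-mod}$ and, for $2\le i\le n$, injective envelopes $h_i:X_i\to I_i$; let $Y_i$ be the pushout of $\phi_1\cdots\phi_{i-1}:X_i\to X_1$ and $h_i$, with structure maps $g_i:X_1\to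 Y_i$ and $j_i:I_i\to Y_i$. For $2\le i\le n-1$ choose $e_i:I_{i+1}\to I_i$ with $e_ih_{i+1}=h_i\phi_i$, and let $\psi_{i-1}:Y_{i+1}\to Y_i$ be the map with $\psi_{i-1}g_{i+1}=g_i$ and $\psi_{i-1}j_{i+1}=j_ie_i$. Put $\psi_{n-1}=g_n$. Then $\mathbf{Rot}\,X_{(\underline{\phi_i})}$ is $$X_1\xrightarrow{\underline{\psi_{n-1}}}Y_n\xrightarrow{\underline{\psi_{n-2}}}\cdots\xrightarrow{\underline{\psi_1}}Y_2 .$$ Let $\Omega^{-1}$ be the cosyzygy functor of $A\text{-}\underline{\mathrm{mod}}$ ($\Omega^{-1}M$ is the cokernel of an injective envelope of $M$), applied to all the objects and morphisms of a sequence. Then for every $X_{(\phi_i)}\in\mathrm{Mor}_n(A\text{-mod})$ and every $j\ge 1$, the iterated rotation and the iterated cosyzygy exist and $$\mathbf{Rot}^{\,j(n+1)}X_{(\underline{\phi_i})}\;\cong\;\Omega^{-j(n-1)}X_{(\underline{\phi_i})}\quad\text{in }\mathrm{Mor}_n(A\text{-}\underline{\mathrm{mod}}),$$ whatever choices are made in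 forming the iterated rotation and the iterated cosyzygy. -/

import Mathlib

open CategoryTheory

universe u w

namespace StableMor

section Modules

variable {A : Type u} [Ring A]

/-- A homomorphism `h : M ⟶ I` of finitely generated left `A`-modules is an injective envelope:
`I` is injective, `h` is a monomorphism, and the image of `h` is an essential submodule of `I`. -/
structure IsInjectiveEnvelope {M I : FGModuleCat.{u} A} (h : M ⟶ I) : Prop where
  injective_module : Module.Injective A I
  injective_hom : Function.Injective h.hom.hom
  essential : ∀ N : Submodule A I, N ⊓ LinearMap.range h.hom.hom = ⊥ → N = ⊥

variable (A) in
/-- Two homomorphisms of finitely generated left `A`-modules are identified in the stable category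
if their difference factors through a finitely generated projective module. -/
def stableRel : HomRel (FGModuleCat.{u} A) := fun M N f g =>
  ∃ (P : FGModuleCat.{u} A) (a : M ⟶ P) (b : P ⟶ N), Module.Projective A P ∧ f - g = a ≫ b

variable (A) in
/-- `stableRel A` is an equivalence relation on each Hom-group and is compatible with
composition, so that the morphisms of the quotient category below are exactly the classes of
homomorphisms modulo those that factor through a projective module. -/
instance stableRel_congruence : Congruence (stableRel A) where
  equivalence := by
    intro X Y
    refine ⟨fun f => ?_, ?_, ?_⟩
    · exact ⟨FGModuleCat.of A PUnit.{u + 1}, 0, 0, inferInstance, by simp⟩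
    · rintro f g ⟨P, a, b, hP, h⟩
      refine ⟨P, a, -b, hP, ?_⟩
      rw [Preadditive.comp_neg, ← h, neg_sub]
    · rintro f g k ⟨P, a, b, hP, h⟩ ⟨Q, c, d, hQ, h'⟩
      refine ⟨FGModuleCat.of A (P × Q), FGModuleCat.ofHom (a.hom.hom.prod c.hom.hom),
        FGModuleCat.ofHom (b.hom.hom.coprod d.hom.hom), ?_, ?_⟩
      · have : Module.Projective A P := hP
        have : Module.Projective A Q := hQ
        exact inferInstanceAs (Module.Projective A (P × Q))
      · rw [← sub_add_sub_cancel f g k, h, h']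
        rfl
  comp_left := by
    rintro X Y Z f g g' ⟨P, a, b, hP, h⟩
    exact ⟨P, f ≫ a, b, hP, by rw [← Preadditive.comp_sub, h, Category.assoc]⟩
  comp_right := by
    rintro X Y Z f f' g ⟨P, a, b, hP, h⟩
    exact ⟨P, a, b ≫ g, hP, by rw [← Preadditive.sub_comp, h, Category.assoc]⟩

variable (A) in
/-- The stable category of finitely generated left `A`-modules modulo projective modules. -/
abbrev StableCat := Quotient (stableRel A)

/-- The morphism category `Mor_n(C)`, for `n ≥ 1`: its objects are the sequences
`X_n → X_{n-1} → ⋯ → X_1` of `n` objects and `n - 1` morphisms of `C`, and its morphisms are the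
commutative ladders between them. The object at position `k` (for `0 ≤ k ≤ n - 1`) is the branch
`X_{n-k}`; thus position `0` is `X_n` and the last position is `X_1`. -/
abbrev Mor (n : ℕ) (C : Type*) [Category C] := ComposableArrows C (n - 1)

/-- The sequence `X_(φ_i)` of module homomorphisms, regarded as a sequence in the stable
category. -/
abbrev stab {m : ℕ} (X : ComposableArrows (FGModuleCat.{u} A) m) :
    ComposableArrows (StableCat A) m :=
  ((Quotient.functor (stableRel A)).mapComposableArrows m).obj X

/-- The data of one rotation of a sequence of modules
`X = (X_n → ⋯ → X_1)`, where `n = m + 1` and position `k` of `X` is `X_{n-k}`. The result is the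
sequence of modules `Y = (X_1 → Y_n → ⋯ → Y_2)`: position `0` of `Y` is `X_1` (up to the
isomorphism `first`), and position `k + 1` of `Y` is the pushout `Y_{n-k}` of the composite
`X_{n-k} → X_1` along an injective envelope `X_{n-k} → I_{n-k}`. The maps `Y_{i+1} → Y_i` are
those induced by extensions `I_{i+1} → I_i` of `X_{i+1} → X_i`. -/
structure RotationDiagram {m : ℕ} (X Y : ComposableArrows (FGModuleCat.{u} A) m) where
  /-- The injective modules. -/
  I : Fin m → FGModuleCat.{u} A
  /-- The injective envelopes. -/
  h : ∀ k : Fin m, X.obj k.castSucc ⟶ I k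
  isInjectiveEnvelope : ∀ k, IsInjectiveEnvelope (h k)
  /-- The identification of `X_1` with the first object of the rotation. -/
  first : X.obj (Fin.last m) ≅ Y.obj 0
  /-- The maps from the injective envelopes to the pushouts. -/
  j : ∀ k : Fin m, I k ⟶ Y.obj k.succ
  isPushout : ∀ k : Fin m,
    IsPushout (X.map (homOfLE (Fin.le_last k.castSucc))) (h k)
      (first.hom ≫ Y.map (homOfLE (Fin.zero_le k.succ))) (j k)
  /-- The extensions of the maps of `X` to the injective envelopes. -/
  e : ∀ (k : ℕ) (hk : k + 1 < m), I ⟨k, by lia⟩ ⟶ I ⟨k + 1, hk⟩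
  h_e : ∀ (k : ℕ) (hk : k + 1 < m),
    h ⟨k, by lia⟩ ≫ e k hk = X.map' k (k + 1) ≫ h ⟨k + 1, hk⟩
  j_map : ∀ (k : ℕ) (hk : k + 1 < m),
    j ⟨k, by lia⟩ ≫ Y.map' (k + 1) (k + 2) = e k hk ≫ j ⟨k + 1, hk⟩

/-- `R` is (isomorphic to) the rotation of `X` in the morphism category of the stable category,
formed with some representatives of the morphisms of `X`, some injective envelopes and some
extensions. -/
def IsRotation {m : ℕ} (X R : ComposableArrows (StableCat A) m) : Prop :=
  ∃ M Y : ComposableArrows (FGModuleCat.{u} A) m,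
    Nonempty (stab M ≅ X) ∧ Nonempty (RotationDiagram M Y) ∧ Nonempty (stab Y ≅ R)

/-- A commutative diagram of modules with exact rows `0 → X_i → I_i → Z_i → 0`, in which each
`X_i → I_i` is an injective envelope. Thus `Z_i = Ω⁻¹ X_i`, and the map `Z_{i+1} → Z_i` represents
`Ω⁻¹` of the class of `X_{i+1} → X_i`. -/
structure CosyzygyDiagram {m : ℕ} (X Z : ComposableArrows (FGModuleCat.{u} A) m) where
  /-- The injective modules. -/
  I : ComposableArrows (FGModuleCat.{u} A) m
  /-- The injective envelopes. -/
  h : X ⟶ I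
  /-- The projections onto the cosyzygies. -/
  p : I ⟶ Z
  isInjectiveEnvelope : ∀ k, IsInjectiveEnvelope (h.app k)
  exact : ∀ k, Function.Exact (h.app k).hom.hom (p.app k).hom.hom
  surjective : ∀ k, Function.Surjective (p.app k).hom.hom

/-- `Z` is (isomorphic to) `Ω⁻¹ X`, the result of applying the cosyzygy functor `Ω⁻¹` of the
stable category to all objects and all morphisms of `X`. -/
def IsCosyzygy {m : ℕ} (X Z : ComposableArrows (StableCat A) m) : Prop :=
  ∃ M Y : ComposableArrows (FGModuleCat.{u} A) m,
    Nonempty (stab M ≅ X) ∧ Nonempty (CosyzygyDiagram M Y) ∧ Nonempty (stab Y ≅ Z)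

end Modules

/-- The `k`-fold iterate of an operation on objects that is given, up to isomorphism, by the
relation `r` between the input and the output. -/
def IsIterate {C : Type*} [Category C] (r : C → C → Prop) : ℕ → C → C → Prop
  | 0, X, Y => Nonempty (X ≅ Y)
  | k + 1, X, Y => ∃ S : C, IsIterate r k X S ∧ r S Y

end StableMor

/-! Write m = n - 1. Up to stable isomorphism a sequence of modules is a chain of submodules of a
projective-injective module I. Dividing I by the first step, embedding the quotient in its injective
envelope, and repeating gives a `Strip`: filtered modules indexed by a, with terms X(a,b) that
vanish for b ≤ a and are projective for b ≥ a + m + 2. Its rectangles are bicartesian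
(`Strip.exists_of_map_eq`), so cones and cosyzygies of its maps are again terms of the strip.

Let row a be X(a,a+1) → ⋯ → X(a,a+m+1) and column c be X(c,c+m+1) → ⋯ → X(c+m,c+m+1). Rotation takes
row a to column a and column c to row c + m. Cosyzygy takes row a to column a + 1 and column c to
row c + m + 1. Hence two rotations shift a row by m and two cosyzygies shift it by m + 2, so j(m+2)
rotations and jm cosyzygies of row 0 end at the same row or column (`Strip.rotation_eq_cosyzygy`).

It remains to see that neither operation depends on choices. A stable isomorphism of sequences
commutes with the maps only modulo projectives, and stable commutativity alone does not give a map
of rotations. By `exists_roof` it is represented by a roof of strictly commuting ladders that are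
stably invertible in each position. Such ladders induce stable isomorphisms on cones by the stable
five lemma (`IsShortExact.isIso_map`, `IsCone.exists_map`), compatible with the maps of the
sequences (`IsCone.map_comp_eq`).

All of this needs only that finitely generated projectives and injectives agree and that finitely
generated envelopes exist (`IsFrobenius`). For a selfinjective Artin algebra, the key point is that
every simple left module embeds in A. -/

namespace StableMor

/-! ### Selfinjective Artin algebras: projectives, injectives and envelopes -/

section QuasiFrobenius

variable {A : Type u} [Ring A]

/-- Maximal proper two-sided ideals. -/
def IsMaxTwoSided (p : Ideal A) : Prop :=
  p.IsTwoSided ∧ p ≠ ⊤ ∧ ∀ q : Ideal A, q.IsTwoSided → p ≤ q → q ≠ ⊤ → q = p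

/-- By the descending chain condition on left ideals, some finite intersection of annihilators of
elements lies in all the others. -/
lemma exists_finset_annihilator_le {S : Type u} [AddCommGroup S] [Module A S] [IsArtinianRing A] :
    ∃ s : Finset S, ∀ a : A, (∀ x ∈ s, a • x = 0) → ∀ y : S, a • y = 0 := by
  obtain ⟨s, hs⟩ := Finset.exists_inf_le (fun x : S => LinearMap.ker (LinearMap.toSpanSingleton A S x))
  refine ⟨s, fun a ha y => ?_⟩
  have h : a ∈ s.inf (fun x : S => LinearMap.ker (LinearMap.toSpanSingleton A S x)) := by
    rw [Submodule.mem_finsetInf]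
    intro x hx
    simpa using ha x hx
  simpa using hs y h

/-- Over a left Artinian ring, simple modules with comparable annihilators are isomorphic. -/
theorem nonempty_linearEquiv_of_annihilator_le [IsArtinianRing A]
    {S T : Type u} [AddCommGroup S] [Module A S] [AddCommGroup T] [Module A T]
    [IsSimpleModule A S] [IsSimpleModule A T]
    (h : Module.annihilator A S ≤ Module.annihilator A T) : Nonempty (S ≃ₗ[A] T) := by
  classical
  have := IsSimpleModule.nontrivial A T
  obtain ⟨t, ht⟩ := exists_ne (0 : T)
  -- Discard elements of s until some x cannot be dropped. The left ideal L annihilating the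
  -- remaining ones then maps to S by b ↦ b • x and to T by b ↦ b • t. The second map is nonzero and
  -- kills the kernel of the first, so it factors through a nonzero map S → T.
  have key : ∀ s : Finset S, (∀ a : A, (∀ x ∈ s, a • x = 0) → a • t = 0) →
      Nonempty (S ≃ₗ[A] T) := by
    intro s
    induction s using Finset.induction_on with
    | empty =>
      intro H
      exact absurd (by simpa using H 1 (by simp)) ht
    | insert x s _ ih =>
      intro H
      by_cases H' : ∀ a : A, (∀ x ∈ s, a • x = 0) → a • t = 0
      · exact ih H'
      push Not at H'
      obtain ⟨a, has, hat⟩ := H'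
      let L : Submodule A A := s.inf (fun x : S => LinearMap.ker (LinearMap.toSpanSingleton A S x))
      have hL : ∀ b : A, b ∈ L ↔ ∀ x ∈ s, b • x = 0 := by
        intro b
        simp [L, Submodule.mem_finsetInf]
      let f : L →ₗ[A] S := (LinearMap.toSpanSingleton A S x).comp L.subtype
      let g : L →ₗ[A] T := (LinearMap.toSpanSingleton A T t).comp L.subtype
      have hfg : LinearMap.ker f ≤ LinearMap.ker g := by
        rintro ⟨b, hb⟩ hbf
        have hbx : b • x = 0 := by simpa [f] using hbf
        have : b • t = 0 := H b (by
          intro y hy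
          rcases Finset.mem_insert.1 hy with rfl | hy
          · exact hbx
          · exact (hL b).1 hb y hy)
        simpa [g] using this
      have hg : g ⟨a, (hL a).2 has⟩ ≠ 0 := by simpa [g] using hat
      have hf : f ≠ 0 := by
        intro h0
        apply hg
        have : (⟨a, (hL a).2 has⟩ : L) ∈ LinearMap.ker f := by simp [h0]
        exact hfg this
      have hfs : Function.Surjective f := LinearMap.surjective_of_ne_zero hf
      let φ : S →ₗ[A] T :=
        ((LinearMap.ker f).liftQ g hfg).comp (f.quotKerEquivOfSurjective hfs).symm.toLinearMap
      have hφ : ∀ b : L, φ (f b) = g b := by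
        intro b
        have : (f.quotKerEquivOfSurjective hfs).symm (f b) = Submodule.Quotient.mk b := by
          rw [LinearEquiv.symm_apply_eq]; rfl
        simp only [φ, LinearMap.comp_apply, LinearEquiv.coe_coe, this]
        rfl
      have hφ0 : φ ≠ 0 := by
        intro h0
        apply hg
        rw [← hφ, h0]
        rfl
      exact ⟨LinearEquiv.ofBijective φ (LinearMap.bijective_of_ne_zero hφ0)⟩
  obtain ⟨s, hs⟩ := exists_finset_annihilator_le (A := A) (S := S)
  refine key s fun a ha => ?_
  exact Module.mem_annihilator.1 (h (Module.mem_annihilator.2 (hs a ha))) t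

instance annihilator_isTwoSided (S : Type u) [AddCommGroup S] [Module A S] :
    (Module.annihilator A S).IsTwoSided :=
  ⟨fun {a} b ha => Module.mem_annihilator.2 fun s => by
    rw [mul_smul]; exact Module.mem_annihilator.1 ha _⟩

/-- A proper two-sided ideal q above the annihilator lies in a maximal left ideal M, and being
two-sided it kills A/M. Comparing annihilators gives S ≅ A/M, so q kills S. -/
lemma isMaxTwoSided_annihilator [IsArtinianRing A]
    (S : Type u) [AddCommGroup S] [Module A S] [IsSimpleModule A S] :
    IsMaxTwoSided (Module.annihilator A S) := by
  have := IsSimpleModule.nontrivial A S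
  refine ⟨inferInstance, ?_, ?_⟩
  · intro h
    obtain ⟨t, ht⟩ := exists_ne (0 : S)
    exact ht (by simpa using Module.mem_annihilator.1 (h ▸ Submodule.mem_top : (1 : A) ∈ _) t)
  · intro q hq hle hne
    obtain ⟨M, hM, hqM⟩ := Ideal.exists_le_maximal q hne
    have : IsSimpleModule A (A ⧸ M) := isSimpleModule_iff_isCoatom.2 hM.out
    have hqT : q ≤ Module.annihilator A (A ⧸ M) := by
      intro a ha
      rw [Module.mem_annihilator]
      intro y
      obtain ⟨y, rfl⟩ := Submodule.Quotient.mk_surjective M y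
      rw [← Submodule.Quotient.mk_smul, Submodule.Quotient.mk_eq_zero]
      exact hqM (hq.mul_mem_of_left y ha)
    obtain ⟨e⟩ := nonempty_linearEquiv_of_annihilator_le (hle.trans hqT)
    exact le_antisymm (hqT.trans e.annihilator_eq.ge) hle

/-- Some finite intersection of these ideals is contained in all of them. Distinct ones are
comaximal, so an ideal outside the finite family would be comaximal with that intersection and could
not contain it. -/
lemma finite_setOf_isMaxTwoSided [IsArtinianRing A] : {p : Ideal A | IsMaxTwoSided p}.Finite := by
  classical
  obtain ⟨s, hs⟩ := Finset.exists_inf_le (fun p : {p : Ideal A // IsMaxTwoSided p} => p.1)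
  suffices H : ∀ p : {p : Ideal A // IsMaxTwoSided p}, p ∈ s by
    have : Finite {p : Ideal A // IsMaxTwoSided p} :=
      Set.finite_univ_iff.1 ((Finset.finite_toSet s).subset fun p _ => H p)
    exact this
  intro p
  by_contra hp
  have key : ∀ t : Finset {p : Ideal A // IsMaxTwoSided p}, p ∉ t →
      ∃ a ∈ t.inf (fun p => p.1), ∃ b ∈ p.1, a + b = 1 := by
    intro t
    induction t using Finset.induction_on with
    | empty => intro _; exact ⟨1, by simp, 0, p.1.zero_mem, by simp⟩
    | insert q t _ ih =>
      intro hpt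
      rw [Finset.mem_insert, not_or] at hpt
      obtain ⟨a, ha, b, hb, hab⟩ := ih hpt.2
      have := p.2.1
      have := q.2.1
      have htop : q.1 ⊔ p.1 = ⊤ := by
        by_contra hne
        have hts : (q.1 ⊔ p.1).IsTwoSided := by
          refine ⟨fun {x} c hx => ?_⟩
          obtain ⟨y, hy, z, hz, rfl⟩ := Submodule.mem_sup.1 hx
          rw [add_mul]
          exact Submodule.add_mem_sup (Ideal.IsTwoSided.mul_mem_of_left c hy)
            (Ideal.IsTwoSided.mul_mem_of_left c hz)
        have h1 := p.2.2.2 _ hts le_sup_right hne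
        have h2 := q.2.2.2 _ hts le_sup_left hne
        exact hpt.1 (Subtype.ext (h1.symm.trans h2))
      obtain ⟨c, hc, d, hd, hcd⟩ := Submodule.mem_sup.1
        (htop ▸ Submodule.mem_top : (1 : A) ∈ q.1 ⊔ p.1)
      have hts : (t.inf (fun p => p.1)).IsTwoSided := by
        refine ⟨fun {x} c hx => ?_⟩
        rw [Submodule.mem_finsetInf] at hx ⊢
        intro r hr
        have := r.2.1
        exact Ideal.IsTwoSided.mul_mem_of_left c (hx r hr)
      refine ⟨c * a, ?_, c * b + d, ?_, ?_⟩
      · rw [Finset.inf_insert]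
        exact ⟨Ideal.IsTwoSided.mul_mem_of_left a hc, Ideal.mul_mem_left _ c ha⟩
      · exact p.1.add_mem (p.1.mul_mem_left c hb) hd
      · rw [← add_assoc, ← mul_add, hab, mul_one, hcd]
  obtain ⟨a, ha, b, hb, hab⟩ := key s hp
  apply p.2.2.1
  rw [Ideal.eq_top_iff_one, ← hab]
  exact p.1.add_mem (hs p ha) hb

/-- Every two-sided ideal is finitely generated as a right ideal. -/
def TwoSidedFG (A : Type u) [Ring A] : Prop :=
  ∀ p : Ideal A, p.IsTwoSided → ∃ (k : ℕ) (y : Fin k → A), (∀ i, y i ∈ p) ∧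
    ∀ x ∈ p, ∃ c : Fin k → A, x = ∑ i, y i * c i

/-- Otherwise x ↦ (x yᵢ), with yᵢ right generators of p, embeds A in a finite free module. A
retraction g exists by injectivity, and 1 = ∑ yᵢ g(eᵢ) then lies in p. -/
lemma exists_ne_zero_mul_eq_zero (hA : Module.Injective A A) (hfg : TwoSidedFG A)
    (p : Ideal A) (hp : p.IsTwoSided) (hne : p ≠ ⊤) :
    ∃ x : A, x ≠ 0 ∧ ∀ a ∈ p, x * a = 0 := by
  obtain ⟨k, y, hy, hgen⟩ := hfg p hp
  by_contra! H
  let f : A →ₗ[A] (Fin k → A) := LinearMap.pi fun i => LinearMap.toSpanSingleton A A (y i)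
  have hf : Function.Injective f := by
    rw [← LinearMap.ker_eq_bot, LinearMap.ker_eq_bot']
    intro x hx
    by_contra hx0
    obtain ⟨a, ha, hxa⟩ := H x hx0
    apply hxa
    obtain ⟨c, rfl⟩ := hgen a ha
    rw [Finset.mul_sum]
    refine Finset.sum_eq_zero fun i _ => ?_
    have : x * y i = 0 := congrFun hx i
    rw [← mul_assoc, this, zero_mul]
  obtain ⟨g, hg⟩ := hA.out f hf LinearMap.id
  apply hne
  rw [Ideal.eq_top_iff_one]
  have h1 : g (f 1) = 1 := hg 1
  have h2 : f 1 = ∑ i, y i • Pi.single i (1 : A) := by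
    ext i
    simp [f, Finset.sum_apply, Pi.single_apply]
  rw [← h1, h2, map_sum]
  refine p.sum_mem fun i _ => ?_
  rw [map_smul]
  exact hp.mul_mem_of_left _ (hy i)

/-- A left self-injective left Artinian ring all of whose two-sided ideals are finitely generated
on the right is left Kasch: it contains every simple left module. -/
theorem exists_injective_of_isSimpleModule [IsArtinianRing A] (hA : Module.Injective A A)
    (hfg : TwoSidedFG A) (S : Type u) [AddCommGroup S] [Module A S] [IsSimpleModule A S] :
    ∃ f : S →ₗ[A] A, Function.Injective f := by
  -- Each maximal two-sided ideal p yields a simple left ideal T p with T p · p = 0. The aim is that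
  -- every simple module occurs among the T p; p itself need not be the left annihilator of T p, so
  -- a counting argument is used.
  have hex : ∀ p : {p : Ideal A // IsMaxTwoSided p}, ∃ T : Submodule A A,
      IsSimpleModule A T ∧ ∀ x ∈ T, ∀ a ∈ p.1, x * a = 0 := by
    rintro ⟨p, hp⟩
    have := hp.1
    let L : Submodule A A :=
      { carrier := {x | ∀ a ∈ p, x * a = 0}
        add_mem' := fun hx hy a ha => by rw [add_mul, hx a ha, hy a ha, add_zero]
        zero_mem' := fun a _ => zero_mul a
        smul_mem' := fun c x hx a ha => by rw [smul_eq_mul, mul_assoc, hx a ha, mul_zero] }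
    obtain ⟨x, hx0, hx⟩ := exists_ne_zero_mul_eq_zero hA hfg p hp.1 hp.2.1
    have hL : L ≠ ⊥ := fun h => hx0 ((Submodule.mem_bot A).1 (h ▸ (show x ∈ L from hx)))
    obtain ⟨T, hT, hTL⟩ := (eq_bot_or_exists_atom_le L).resolve_left hL
    exact ⟨T, isSimpleModule_iff_isAtom.2 hT, fun x hx a ha => hTL hx a ha⟩
  choose T hT hTp using hex
  have hfin : Finite {p : Ideal A // IsMaxTwoSided p} := finite_setOf_isMaxTwoSided
  -- By selfinjectivity a map T p → A is right multiplication by an element, so p kills its image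
  -- from the right as well.
  have hmul : ∀ (p : {p : Ideal A // IsMaxTwoSided p}) (f : T p →ₗ[A] A) (s : T p), ∀ a ∈ p.1,
      f s * a = 0 := by
    intro p f s a ha
    have := p.2.1
    obtain ⟨g, hg⟩ := hA.out (T p).subtype Subtype.val_injective f
    rw [← hg s]
    have : g ((T p).subtype s) = s.1 * g 1 := by
      rw [← smul_eq_mul, ← map_smul]; simp
    rw [this, mul_assoc]
    exact hTp p _ s.2 _ (p.1.mul_mem_left _ ha)
  let Φ : {p : Ideal A // IsMaxTwoSided p} → {p : Ideal A // IsMaxTwoSided p} := fun p =>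
    have := hT p
    ⟨Module.annihilator A (T p), isMaxTwoSided_annihilator _⟩
  -- If T p ≅ T p', the right annihilator Q of all images of T p in A is a proper two-sided ideal
  -- containing both p and p', so p = Q = p'. Finiteness then makes Φ surjective.
  have hΦ : Function.Injective Φ := by
    have hle : ∀ p p' : {p : Ideal A // IsMaxTwoSided p},
        Module.annihilator A (T p) = Module.annihilator A (T p') → p = p' := by
      intro p p' h
      have := hT p
      have := hT p'
      obtain ⟨e⟩ := nonempty_linearEquiv_of_annihilator_le h.le
      let Q : Ideal A :=
        { carrier := {a | ∀ (f : T p →ₗ[A] A) (s : T p), f s * a = 0}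
          add_mem' := fun hx hy f s => by rw [mul_add, hx, hy, add_zero]
          zero_mem' := fun f s => mul_zero _
          smul_mem' := fun c x hx f s => by
            have := hx ((LinearMap.toSpanSingleton A A c).comp f) s
            simpa [mul_assoc] using this }
      have hQ : Q.IsTwoSided := ⟨fun {a} b ha f s => by rw [← mul_assoc, ha f s, zero_mul]⟩
      have hQtop : Q ≠ ⊤ := by
        intro htop
        have := IsSimpleModule.nontrivial A (T p)
        obtain ⟨t, ht⟩ := exists_ne (0 : T p)
        have h1 : (1 : A) ∈ Q := htop ▸ Submodule.mem_top
        exact ht (Subtype.ext (by simpa using h1 (T p).subtype t))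
      have h1 : p.1 ≤ Q := fun a ha f s => hmul p f s a ha
      have h2 : p'.1 ≤ Q := fun a ha f s => by
        have := hmul p' (f.comp e.symm.toLinearMap) (e s) a ha
        simpa using this
      exact Subtype.ext ((p.2.2.2 Q hQ h1 hQtop).symm.trans (p'.2.2.2 Q hQ h2 hQtop))
    intro p p' h
    exact hle p p' (congrArg Subtype.val h)
  obtain ⟨p, hp⟩ := (Finite.injective_iff_surjective.1 hΦ) ⟨_, isMaxTwoSided_annihilator S⟩
  have := hT p
  obtain ⟨e⟩ := nonempty_linearEquiv_of_annihilator_le (S := S) (T := T p)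
    (congrArg Subtype.val hp).ge
  exact ⟨(T p).subtype.comp e.toLinearMap, Subtype.val_injective.comp e.injective⟩

/-- Over a ring as above, every Artinian module embeds into a finite free module. -/
theorem exists_injective_pi [IsArtinianRing A] (hA : Module.Injective A A)
    (hfg : TwoSidedFG A) (M : Type u) [AddCommGroup M] [Module A M] [IsArtinian A M] :
    ∃ (k : ℕ) (f : M →ₗ[A] (Fin k → A)), Function.Injective f := by
  -- Take finitely many functionals whose common kernel is contained in every kernel. A simple
  -- submodule of it would embed in A, and by injectivity that embedding would extend to a
  -- functional not vanishing there.
  obtain ⟨s, hs⟩ := Finset.exists_inf_le (fun f : M →ₗ[A] A => LinearMap.ker f)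
  refine ⟨s.card, LinearMap.pi fun i => (s.equivFin.symm i).1, ?_⟩
  rw [← LinearMap.ker_eq_bot]
  by_contra hne
  obtain ⟨T, hT, hTK⟩ := (eq_bot_or_exists_atom_le _).resolve_left hne
  have : IsSimpleModule A T := isSimpleModule_iff_isAtom.2 hT
  obtain ⟨f, hf⟩ := exists_injective_of_isSimpleModule hA hfg T
  obtain ⟨g, hg⟩ := hA.out T.subtype Subtype.val_injective f
  have := IsSimpleModule.nontrivial A T
  obtain ⟨t, ht⟩ := exists_ne (0 : T)
  apply ht
  apply hf
  rw [map_zero, ← hg]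
  refine hs g ?_
  rw [Submodule.mem_finsetInf]
  intro i hi
  have := congrFun (show LinearMap.pi (fun i => (s.equivFin.symm i).1) t.1 = 0 from hTK t.2)
    (s.equivFin ⟨i, hi⟩)
  simpa using this

lemma injective_of_retract {I J : Type u} [AddCommGroup I] [Module A I] [AddCommGroup J]
    [Module A J] (hJ : Module.Injective A J) (i : I →ₗ[A] J) (r : J →ₗ[A] I)
    (h : ∀ x, r (i x) = x) : Module.Injective A I :=
  ⟨fun X Y _ _ _ _ f hf g => by
    obtain ⟨k, hk⟩ := hJ.out f hf (i.comp g)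
    exact ⟨r.comp k, fun x => by simp [hk, h]⟩⟩

lemma injective_of_projective (hA : Module.Injective A A) (P : Type u) [AddCommGroup P]
    [Module A P] [Module.Finite A P] (hP : Module.Projective A P) : Module.Injective A P := by
  obtain ⟨k, f, hf⟩ := Module.Finite.exists_fin' A P
  obtain ⟨g, hg⟩ := Module.projective_lifting_property f LinearMap.id hf
  have : Module.Injective A (Fin k → A) := inferInstance
  exact injective_of_retract this g f fun x => LinearMap.congr_fun hg x

lemma projective_of_injective [IsArtinianRing A] (hA : Module.Injective A A) (hfg : TwoSidedFG A)
    (I : Type u) [AddCommGroup I] [Module A I] [Module.Finite A I] (hI : Module.Injective A I) :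
    Module.Projective A I := by
  obtain ⟨k, f, hf⟩ := exists_injective_pi hA hfg I
  obtain ⟨g, hg⟩ := hI.out f hf LinearMap.id
  exact Module.Projective.of_split f g (LinearMap.ext hg)

/-- A Noetherian injective module contains an injective envelope of each of its submodules. -/
theorem exists_essential_injective {E : Type u} [AddCommGroup E] [Module A E] [IsNoetherian A E]
    (hE : Module.Injective A E) (M : Submodule A E) :
    ∃ N : Submodule A E, M ≤ N ∧ Module.Injective A N ∧
      ∀ K : Submodule A E, K ≤ N → K ⊓ M = ⊥ → K = ⊥ := by
  -- N is a maximal essential extension of M inside E, and C below is maximal among the submodules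
  -- meeting N trivially. Then N embeds in E/C, its inclusion extends to g : E/C → E, and E → E/C →
  -- E turns out to be a retraction onto N.
  obtain ⟨N, ⟨hMN, hess⟩, hmax⟩ := WellFounded.has_min
    (wellFounded_gt : WellFounded ((· > ·) : Submodule A E → Submodule A E → Prop))
    {N | M ≤ N ∧ ∀ K : Submodule A E, K ≤ N → K ⊓ M = ⊥ → K = ⊥}
    ⟨M, le_rfl, fun K hK h => by rwa [inf_eq_left.2 hK] at h⟩
  obtain ⟨C, hC, hCmax⟩ := WellFounded.has_min
    (wellFounded_gt : WellFounded ((· > ·) : Submodule A E → Submodule A E → Prop))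
    {C | C ⊓ N = ⊥} ⟨⊥, by simp⟩
  refine ⟨N, hMN, ?_, hess⟩
  let q : N →ₗ[A] E ⧸ C := C.mkQ.comp N.subtype
  have hq : Function.Injective q := by
    rw [← LinearMap.ker_eq_bot, LinearMap.ker_eq_bot']
    intro x hx
    have : x.1 ∈ C ⊓ N := ⟨(Submodule.Quotient.mk_eq_zero C).1 hx, x.2⟩
    rw [hC] at this
    exact Subtype.ext this
  obtain ⟨g, hg⟩ := hE.out q hq N.subtype
  have hg' : ∀ x ∈ N, g (C.mkQ x) = x := fun x hx => hg ⟨x, hx⟩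
  have hginj : LinearMap.ker g = ⊥ := by
    have hD : (LinearMap.ker g).comap C.mkQ = C := by
      have hle : C ≤ (LinearMap.ker g).comap C.mkQ := by
        intro x hx
        simp [(Submodule.Quotient.mk_eq_zero C).2 hx]
      by_contra hne
      refine hCmax ((LinearMap.ker g).comap C.mkQ) ?_ (lt_of_le_of_ne hle (Ne.symm hne))
      rw [Set.mem_ofPred_eq, eq_bot_iff]
      rintro x ⟨hx, hxN⟩
      have : g (C.mkQ x) = 0 := hx
      rw [hg' x hxN] at this
      exact this
    rw [LinearMap.ker_eq_bot']
    intro y hy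
    obtain ⟨x, rfl⟩ := C.mkQ_surjective y
    have : x ∈ (LinearMap.ker g).comap C.mkQ := hy
    rw [hD] at this
    exact (Submodule.Quotient.mk_eq_zero C).2 this
  -- The range of g is essential over M: if K in the range misses M, it misses N, and its preimage
  -- in E contains C and misses N, hence equals C, so K = 0. Maximality of N finishes.
  have hrange : LinearMap.range g = N := by
    have hle : N ≤ LinearMap.range g := fun x hx => ⟨_, hg' x hx⟩
    by_contra hne
    refine hmax (LinearMap.range g) ⟨hMN.trans hle, ?_⟩ (lt_of_le_of_ne hle (Ne.symm hne))
    intro K hK hKM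
    have hKN : K ⊓ N = ⊥ := by
      apply hess _ inf_le_right
      rw [eq_bot_iff, ← hKM]
      exact inf_le_inf_right _ inf_le_left
    have hpre : (K.comap g).comap C.mkQ = C := by
      have hle' : C ≤ (K.comap g).comap C.mkQ := by
        intro x hx
        have : C.mkQ x = 0 := (Submodule.Quotient.mk_eq_zero C).2 hx
        simp only [Submodule.mem_comap, this, map_zero, K.zero_mem]
      by_contra hne'
      refine hCmax _ ?_ (lt_of_le_of_ne hle' (Ne.symm hne'))
      rw [Set.mem_ofPred_eq, eq_bot_iff]
      rintro x ⟨hx, hxN⟩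
      have hx' : g (C.mkQ x) ∈ K := hx
      rw [hg' x hxN] at hx'
      rw [← hKN]
      exact ⟨hx', hxN⟩
    rw [eq_bot_iff]
    intro y hy
    obtain ⟨z, rfl⟩ := hK hy
    obtain ⟨x, rfl⟩ := C.mkQ_surjective z
    have hx : x ∈ (K.comap g).comap C.mkQ := hy
    rw [hpre] at hx
    have : C.mkQ x = 0 := (Submodule.Quotient.mk_eq_zero C).2 hx
    rw [this, map_zero]
    exact Submodule.zero_mem _
  refine injective_of_retract hE N.subtype
    ((g.comp C.mkQ).codRestrict N fun x => hrange ▸ ⟨C.mkQ x, rfl⟩) fun x => ?_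
  exact Subtype.ext (hg' x.1 x.2)

/-- Over a left self-injective ring as above, finitely generated modules have finitely generated
injective envelopes. -/
theorem exists_isInjectiveEnvelope [IsArtinianRing A] (hA : Module.Injective A A)
    (hfg : TwoSidedFG A) (M : FGModuleCat.{u} A) :
    ∃ (I : FGModuleCat.{u} A) (h : M ⟶ I), IsInjectiveEnvelope h := by
  obtain ⟨k, f, hf⟩ := exists_injective_pi hA hfg M
  obtain ⟨N, hMN, hN, hess⟩ := exists_essential_injective (A := A) (E := Fin k → A) inferInstance
    (LinearMap.range f)
  let h : M →ₗ[A] N := f.codRestrict N fun x => hMN ⟨x, rfl⟩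
  refine ⟨FGModuleCat.of A N, FGModuleCat.ofHom h, hN, ?_, ?_⟩
  · intro x y hxy
    exact hf (congrArg Subtype.val (show h x = h y from hxy))
  · intro K hK
    have hK' : (K.map N.subtype) ⊓ LinearMap.range f = ⊥ := by
      rw [eq_bot_iff]
      rintro _ ⟨⟨y, hy, rfl⟩, ⟨x, hx⟩⟩
      have : y ∈ K ⊓ LinearMap.range h := ⟨hy, x, Subtype.ext hx⟩
      rw [show K ⊓ LinearMap.range h = ⊥ from hK] at this
      rw [(Submodule.mem_bot A).1 this]
      simp
    have := hess _ (Submodule.map_subtype_le N K) hK'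
    exact Submodule.map_injective_of_injective N.subtype_injective (by rw [this, Submodule.map_bot])

/-- A two-sided ideal is a submodule of the Noetherian R-module A, and since R acts centrally its
R-generators also generate it on the right. -/
lemma twoSidedFG_of_algebra {R : Type w} [CommRing R] [IsArtinianRing R] [Algebra R A]
    [Module.Finite R A] : TwoSidedFG A := by
  intro p _
  have : IsNoetherian R A := inferInstance
  obtain ⟨k, y, hy⟩ := Submodule.fg_iff_exists_fin_generating_family.1
    (IsNoetherian.noetherian (p.restrictScalars R))
  refine ⟨k, y, fun i => ?_, fun x hx => ?_⟩
  · have : y i ∈ p.restrictScalars R := hy ▸ Submodule.subset_span ⟨i, rfl⟩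
    exact this
  · have : x ∈ p.restrictScalars R := hx
    rw [← hy, Submodule.mem_span_range_iff_exists_fun] at this
    obtain ⟨c, rfl⟩ := this
    exact ⟨fun i => algebraMap R A (c i), Finset.sum_congr rfl fun i _ => by
      rw [← Algebra.commutes, Algebra.smul_def]⟩

end QuasiFrobenius

/-! ### The stable category and maps into projectives -/

section Stable

variable {A : Type u} [Ring A]

instance : Preadditive (StableCat A) :=
  Quotient.preadditive (stableRel A) (by
    rintro X Y f₁ f₂ g₁ g₂ hf hg
    have h1 : stableRel A (f₁ + g₁) (f₂ + g₁) := by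
      obtain ⟨P, a, b, hP, h⟩ := hf
      exact ⟨P, a, b, hP, by rw [← h]; abel⟩
    have h2 : stableRel A (f₂ + g₁) (f₂ + g₂) := by
      obtain ⟨P, a, b, hP, h⟩ := hg
      exact ⟨P, a, b, hP, by rw [← h]; abel⟩
    exact Congruence.equivalence.trans h1 h2)

variable (A) in
/-- The projection from modules to the stable category. -/
abbrev toStable : FGModuleCat.{u} A ⥤ StableCat A := Quotient.functor (stableRel A)

instance : (toStable A).Additive := Quotient.functor_additive (stableRel A) _

lemma toStable_map_eq_zero_iff {M N : FGModuleCat.{u} A} (f : M ⟶ N) :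
    (toStable A).map f = 0 ↔
      ∃ (P : FGModuleCat.{u} A) (a : M ⟶ P) (b : P ⟶ N), Module.Projective A P ∧ f = a ≫ b := by
  rw [← (toStable A).map_zero, Quotient.functor_map_eq_iff]
  simp only [stableRel, sub_zero]

lemma toStable_map_eq_iff {M N : FGModuleCat.{u} A} (f g : M ⟶ N) :
    (toStable A).map f = (toStable A).map g ↔
      ∃ (P : FGModuleCat.{u} A) (a : M ⟶ P) (b : P ⟶ N), Module.Projective A P ∧
        f - g = a ≫ b :=
  Quotient.functor_map_eq_iff _ _ _

lemma toStable_map_comp_eq_zero {M P N : FGModuleCat.{u} A} (hP : Module.Projective A P)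
    (a : M ⟶ P) (b : P ⟶ N) : (toStable A).map (a ≫ b) = 0 :=
  (toStable_map_eq_zero_iff _).2 ⟨P, a, b, hP, rfl⟩

variable (A) in
/-- The finitely generated projective modules are the finitely generated injective modules, and
finitely generated modules have finitely generated injective envelopes. -/
structure IsFrobenius : Prop where
  projective_iff : ∀ P : FGModuleCat.{u} A, Module.Projective A P ↔ Module.Injective A P
  exists_envelope : ∀ M : FGModuleCat.{u} A,
    ∃ (I : FGModuleCat.{u} A) (h : M ⟶ I), IsInjectiveEnvelope h

/-- Extension along a monomorphism of homomorphisms into a projective module. -/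
lemma IsFrobenius.exists_extension (hA : IsFrobenius A) {X E P : FGModuleCat.{u} A}
    (hP : Module.Projective A P) (i : X ⟶ E) (hi : Function.Injective i.hom.hom) (a : X ⟶ P) :
    ∃ b : E ⟶ P, i ≫ b = a := by
  obtain ⟨b, hb⟩ := ((hA.projective_iff P).1 hP).out i.hom.hom hi a.hom.hom
  exact ⟨FGModuleCat.ofHom b, by ext x; exact hb x⟩

/-! ### Short exact sequences and the stable five lemma -/

/-- A short exact sequence `0 → X → E → Y → 0` of finitely generated modules. -/
structure IsShortExact {X E Y : FGModuleCat.{u} A} (i : X ⟶ E) (p : E ⟶ Y) : Prop where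
  injective : Function.Injective i.hom.hom
  exact : Function.Exact i.hom.hom p.hom.hom
  surjective : Function.Surjective p.hom.hom

namespace IsShortExact

variable {X E Y : FGModuleCat.{u} A} {i : X ⟶ E} {p : E ⟶ Y}

lemma comp_eq_zero (S : IsShortExact i p) : i ≫ p = 0 := by
  ext x
  exact S.exact.apply_apply_eq_zero x

lemma exists_desc (S : IsShortExact i p) {Z : FGModuleCat.{u} A} (d : E ⟶ Z) (hd : i ≫ d = 0) :
    ∃ δ : Y ⟶ Z, p ≫ δ = d := by
  have hker : LinearMap.ker p.hom.hom ≤ LinearMap.ker d.hom.hom := by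
    intro x hx
    obtain ⟨y, rfl⟩ := (S.exact x).1 hx
    have : (i ≫ d).hom.hom y = 0 := by rw [hd]; rfl
    exact this
  let δ : Y →ₗ[A] Z := ((LinearMap.ker p.hom.hom).liftQ d.hom.hom hker).comp
    (p.hom.hom.quotKerEquivOfSurjective S.surjective).symm.toLinearMap
  refine ⟨FGModuleCat.ofHom δ, ?_⟩
  ext x
  have : (p.hom.hom.quotKerEquivOfSurjective S.surjective).symm (p.hom.hom x) =
      Submodule.Quotient.mk x := by
    rw [LinearEquiv.symm_apply_eq]; rfl
  change δ (p.hom.hom x) = d.hom.hom x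
  simp only [δ, LinearMap.comp_apply, LinearEquiv.coe_coe, this]
  rfl

lemma hom_ext (S : IsShortExact i p) {Z : FGModuleCat.{u} A} {c d : Y ⟶ Z}
    (h : p ≫ c = p ≫ d) : c = d := by
  ext y
  obtain ⟨x, rfl⟩ := S.surjective y
  exact congrArg (fun f : E ⟶ Z => f.hom.hom x) h

/-- An endomorphism of a short exact sequence that is stably the identity on the first two terms
is stably unipotent, hence stably invertible, on the third. -/
lemma isIso_of_map_eq_id (hA : IsFrobenius A) (S : IsShortExact i p) {u : X ⟶ X} {v : E ⟶ E}
    {w : Y ⟶ Y} (huv : i ≫ v = u ≫ i) (hvw : p ≫ w = v ≫ p)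
    (hu : (toStable A).map u = 𝟙 _) (hv : (toStable A).map v = 𝟙 _) :
    IsIso ((toStable A).map w) := by
  rw [← (toStable A).map_id, toStable_map_eq_iff] at hu
  obtain ⟨P, a, b, hP, hab⟩ := hu
  obtain ⟨a', rfl⟩ := hA.exists_extension hP i S.injective a
  -- Subtracting from v - 1 its part through P leaves a map that kills X, hence descends to δ : Y →
  -- E. Then w - 1 = δ ≫ p, while p ≫ δ is stably zero, so w - 1 squares to zero stably.
  obtain ⟨δ, hδ⟩ := S.exists_desc (v - 𝟙 E - a' ≫ b ≫ i) (by
    have : i ≫ a' ≫ b ≫ i = u ≫ i - i := by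
      have := congrArg (· ≫ i) hab
      simp only [Preadditive.sub_comp, Category.id_comp, Category.assoc] at this
      rw [this]
    simp only [Preadditive.comp_sub, Category.comp_id, this, huv]
    abel)
  have hw : w - 𝟙 Y = δ ≫ p := by
    apply S.hom_ext
    rw [← Category.assoc, hδ]
    simp only [Preadditive.sub_comp, Preadditive.comp_sub, Category.id_comp, Category.comp_id,
      Category.assoc, S.comp_eq_zero, Limits.comp_zero, hvw]
    abel
  have h0 : (toStable A).map (p ≫ δ) = 0 := by
    rw [hδ, Functor.map_sub, Functor.map_sub, hv, (toStable A).map_id, toStable_map_comp_eq_zero hP]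
    simp
  have hsq : (toStable A).map (δ ≫ p) ≫ (toStable A).map (δ ≫ p) = 0 := by
    rw [← Functor.map_comp, show (δ ≫ p) ≫ δ ≫ p = δ ≫ (p ≫ δ) ≫ p by simp]
    rw [Functor.map_comp, Functor.map_comp, h0]
    simp
  have hw' : (toStable A).map w = 𝟙 _ + (toStable A).map (δ ≫ p) := by
    rw [← hw, Functor.map_sub, (toStable A).map_id]
    abel
  rw [hw']
  refine ⟨𝟙 _ - (toStable A).map (δ ≫ p), ?_, ?_⟩ <;>
  · simp only [Preadditive.add_comp, Preadditive.comp_sub, Preadditive.sub_comp,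
      Preadditive.comp_add, Category.id_comp, Category.comp_id, hsq]
    abel

/-- A homomorphism of short exact sequences that is stably invertible on the first two terms has
an inverse up to stably unipotent endomorphisms. -/
lemma exists_stable_inverse (hA : IsFrobenius A) (S : IsShortExact i p)
    {X' E' Y' : FGModuleCat.{u} A} {i' : X' ⟶ E'} {p' : E' ⟶ Y'} (S' : IsShortExact i' p')
    {u : X ⟶ X'} {v : E ⟶ E'} (huv : i ≫ v = u ≫ i')
    [IsIso ((toStable A).map u)] [IsIso ((toStable A).map v)] :
    ∃ (u' : X' ⟶ X) (v' : E' ⟶ E) (w' : Y' ⟶ Y), i' ≫ v' = u' ≫ i ∧ p' ≫ w' = v' ≫ p ∧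
      (toStable A).map u' = inv ((toStable A).map u) ∧
      (toStable A).map v' = inv ((toStable A).map v) := by
  obtain ⟨u', hu'⟩ := (toStable A).map_surjective (inv ((toStable A).map u))
  obtain ⟨v₀, hv₀⟩ := (toStable A).map_surjective (inv ((toStable A).map v))
  have h : (toStable A).map (i' ≫ v₀) = (toStable A).map (u' ≫ i) := by
    rw [Functor.map_comp, Functor.map_comp, hu', hv₀, IsIso.eq_inv_comp, ← Category.assoc,
      IsIso.comp_inv_eq, ← Functor.map_comp, ← Functor.map_comp, huv]
  obtain ⟨P, a, b, hP, hab⟩ := (toStable_map_eq_iff _ _).1 h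
  -- The stable inverses commute with i and i' only up to a map through P. Extending its first
  -- factor to E' lets v₀ be corrected, within its stable class, so that the square commutes
  -- strictly.
  obtain ⟨a', rfl⟩ := hA.exists_extension hP i' S'.injective a
  have h1 : i' ≫ (v₀ - a' ≫ b) = u' ≫ i := by
    rw [Preadditive.comp_sub, ← Category.assoc i' a' b, ← hab]
    abel
  obtain ⟨w', hw'⟩ := S'.exists_desc ((v₀ - a' ≫ b) ≫ p) (by
    rw [← Category.assoc, h1, Category.assoc, S.comp_eq_zero, Limits.comp_zero])
  refine ⟨u', v₀ - a' ≫ b, w', h1, hw', hu', ?_⟩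
  rw [Functor.map_sub, hv₀, toStable_map_comp_eq_zero hP, sub_zero]

/-- The five lemma for stable isomorphisms. -/
theorem isIso_map (hA : IsFrobenius A) (S : IsShortExact i p)
    {X' E' Y' : FGModuleCat.{u} A} {i' : X' ⟶ E'} {p' : E' ⟶ Y'} (S' : IsShortExact i' p')
    {u : X ⟶ X'} {v : E ⟶ E'} {w : Y ⟶ Y'} (huv : i ≫ v = u ≫ i') (hvw : p ≫ w = v ≫ p')
    (hu : IsIso ((toStable A).map u)) (hv : IsIso ((toStable A).map v)) :
    IsIso ((toStable A).map w) := by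
  obtain ⟨u', v', w', h1, h2, hu', hv'⟩ := S.exists_stable_inverse hA S' huv
  have hl : IsIso ((toStable A).map w ≫ (toStable A).map w') := by
    rw [← Functor.map_comp]
    refine S.isIso_of_map_eq_id hA (u := u ≫ u') (v := v ≫ v') ?_ ?_ ?_ ?_
    · rw [← Category.assoc, huv, Category.assoc, h1, Category.assoc]
    · rw [← Category.assoc, hvw, Category.assoc, h2, Category.assoc]
    · rw [Functor.map_comp, hu', IsIso.hom_inv_id]
    · rw [Functor.map_comp, hv', IsIso.hom_inv_id]
  have hr : IsIso ((toStable A).map w' ≫ (toStable A).map w) := by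
    rw [← Functor.map_comp]
    refine S'.isIso_of_map_eq_id hA (u := u' ≫ u) (v := v' ≫ v) ?_ ?_ ?_ ?_
    · rw [← Category.assoc, h1, Category.assoc, huv, Category.assoc]
    · rw [← Category.assoc, h2, Category.assoc, hvw, Category.assoc]
    · rw [Functor.map_comp, hu', IsIso.inv_hom_id]
    · rw [Functor.map_comp, hv', IsIso.inv_hom_id]
  have : IsSplitMono ((toStable A).map w) :=
    IsSplitMono.mk' ⟨(toStable A).map w' ≫ inv ((toStable A).map w ≫ (toStable A).map w'), by
      rw [← Category.assoc, IsIso.hom_inv_id]⟩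
  have : Epi ((toStable A).map w) := epi_of_epi ((toStable A).map w') _
  exact isIso_of_epi_of_isSplitMono _

end IsShortExact

/-! ### Cones and their functoriality -/

/-- The square with sides `f : X ⟶ W`, `h : X ⟶ I`, `g : W ⟶ Y`, `j : I ⟶ Y` is bicartesian and
`I` is projective, so that `Y` is the cone of `f` in the stable category. -/
structure IsCone {X W I Y : FGModuleCat.{u} A} (f : X ⟶ W) (h : X ⟶ I) (g : W ⟶ Y) (j : I ⟶ Y) :
    Prop where
  projective : Module.Projective A I
  comm : f ≫ g = h ≫ j
  injective : ∀ x, f.hom.hom x = 0 → h.hom.hom x = 0 → x = 0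
  exact : ∀ y z, g.hom.hom y = j.hom.hom z → ∃ x, f.hom.hom x = y ∧ h.hom.hom x = z
  surjective : ∀ y, ∃ w z, g.hom.hom w + j.hom.hom z = y

namespace IsCone

variable {X W I Y : FGModuleCat.{u} A} {f : X ⟶ W} {h : X ⟶ I} {g : W ⟶ Y} {j : I ⟶ Y}

/-- A bicartesian square is an exact sequence X → W ⊕ I → Y; the sign on j makes the composite
vanish. In this form the five lemma applies to cones. -/
lemma isShortExact (C : IsCone f h g j) :
    IsShortExact (X := X) (E := FGModuleCat.of A (W × I)) (Y := Y)
      (FGModuleCat.ofHom (f.hom.hom.prod h.hom.hom))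
      (FGModuleCat.ofHom (g.hom.hom.coprod (-j.hom.hom))) where
  injective := by
    refine (injective_iff_map_eq_zero _).2 fun x hx => ?_
    exact C.injective x (congrArg Prod.fst hx) (congrArg Prod.snd hx)
  exact := by
    rintro ⟨y, z⟩
    constructor
    · intro hyz
      have : g.hom.hom y + -j.hom.hom z = 0 := hyz
      obtain ⟨x, rfl, rfl⟩ := C.exact y z (by rwa [← sub_eq_add_neg, sub_eq_zero] at this)
      exact ⟨x, rfl⟩
    · rintro ⟨x, hx⟩
      obtain ⟨rfl, rfl⟩ := Prod.mk.inj hx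
      change g.hom.hom (f.hom.hom x) + -j.hom.hom (h.hom.hom x) = 0
      have : (f ≫ g).hom.hom x = (h ≫ j).hom.hom x := by rw [C.comm]
      rw [← sub_eq_add_neg, sub_eq_zero]
      exact this
  surjective := by
    intro y
    obtain ⟨w, z, rfl⟩ := C.surjective y
    refine ⟨(w, -z), ?_⟩
    change g.hom.hom w + -j.hom.hom (-z) = _
    rw [map_neg, neg_neg]

lemma exists_desc (C : IsCone f h g j) {Z : FGModuleCat.{u} A} (a : W ⟶ Z) (b : I ⟶ Z)
    (hab : f ≫ a = h ≫ b) : ∃ c : Y ⟶ Z, g ≫ c = a ∧ j ≫ c = b := by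
  obtain ⟨c, hc⟩ := C.isShortExact.exists_desc (Z := Z)
    (FGModuleCat.ofHom (a.hom.hom.coprod (-b.hom.hom))) (by
      ext x
      change a.hom.hom (f.hom.hom x) + -b.hom.hom (h.hom.hom x) = 0
      rw [← sub_eq_add_neg, sub_eq_zero]
      exact congrArg (fun k : X ⟶ Z => k.hom.hom x) hab)
  refine ⟨c, ?_, ?_⟩
  · ext x
    have := congrArg (fun k : FGModuleCat.of A (W × I) ⟶ Z => k.hom.hom (x, 0)) hc
    change c.hom.hom (g.hom.hom x + -j.hom.hom 0) = a.hom.hom x + -b.hom.hom 0 at this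
    simpa using this
  · ext x
    have := congrArg (fun k : FGModuleCat.of A (W × I) ⟶ Z => k.hom.hom (0, -x)) hc
    change c.hom.hom (g.hom.hom 0 + -j.hom.hom (-x)) = a.hom.hom 0 + -b.hom.hom (-x) at this
    simpa using this

lemma hom_ext (C : IsCone f h g j) {Z : FGModuleCat.{u} A} {c d : Y ⟶ Z}
    (hg : g ≫ c = g ≫ d) (hj : j ≫ c = j ≫ d) : c = d := by
  ext y
  obtain ⟨w, z, rfl⟩ := C.surjective y
  rw [map_add, map_add]
  exact congrArg₂ (· + ·) (congrArg (fun k : W ⟶ Z => k.hom.hom w) hg)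
    (congrArg (fun k : I ⟶ Z => k.hom.hom z) hj)

lemma exists_extension (hA : IsFrobenius A) (C : IsCone f h g j) {P : FGModuleCat.{u} A}
    (hP : Module.Projective A P) (k : X ⟶ P) :
    ∃ (α : W ⟶ P) (β : I ⟶ P), f ≫ α + h ≫ β = k := by
  obtain ⟨b, hb⟩ := hA.exists_extension hP _ C.isShortExact.injective k
  refine ⟨FGModuleCat.ofHom (b.hom.hom.comp (LinearMap.inl A W I)),
    FGModuleCat.ofHom (b.hom.hom.comp (LinearMap.inr A W I)), ?_⟩
  rw [← hb]
  ext x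
  change b.hom.hom (f.hom.hom x, 0) + b.hom.hom (0, h.hom.hom x) =
    b.hom.hom (f.hom.hom x, h.hom.hom x)
  rw [← map_add]
  simp

variable {X' W' I' Y' : FGModuleCat.{u} A} {f' : X' ⟶ W'} {h' : X' ⟶ I'} {g' : W' ⟶ Y'}
  {j' : I' ⟶ Y'}

/-- A square of stable isomorphisms induces a stable isomorphism on the cones. -/
lemma exists_map (hA : IsFrobenius A) (C : IsCone f h g j) (C' : IsCone f' h' g' j')
    {u : X ⟶ X'} {v : W ⟶ W'} (huv : f ≫ v = u ≫ f') (hu : IsIso ((toStable A).map u))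
    (hv : IsIso ((toStable A).map v)) :
    ∃ (α : W ⟶ I') (β : I ⟶ I') (w : Y ⟶ Y'), f ≫ α + h ≫ β = u ≫ h' ∧
      g ≫ w = v ≫ g' - α ≫ j' ∧ j ≫ w = β ≫ j' ∧ IsIso ((toStable A).map w) := by
  -- As h need not be injective, u ≫ h' may not extend along h alone; it extends along (f, h). The
  -- component α on W is the price: g ≫ w equals v ≫ g' only up to a map through I'.
  obtain ⟨α, β, hαβ⟩ := C.exists_extension hA C'.projective (u ≫ h')
  obtain ⟨w, hgw, hjw⟩ := C.exists_desc (v ≫ g' - α ≫ j') (β ≫ j') (by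
    have h1 : f ≫ v ≫ g' = u ≫ h' ≫ j' := by
      rw [← Category.assoc, huv, Category.assoc, C'.comm]
    have h2 := congrArg (· ≫ j') hαβ
    simp only [Preadditive.add_comp, Category.assoc] at h2
    rw [Preadditive.comp_sub, h1, ← h2]
    abel)
  refine ⟨α, β, w, hαβ, hgw, hjw, ?_⟩
  let E := FGModuleCat.of A (W × I)
  let E' := FGModuleCat.of A (W' × I')
  let π : E ⟶ W := FGModuleCat.ofHom (LinearMap.fst A W I)
  let ι : W ⟶ E := FGModuleCat.ofHom (LinearMap.inl A W I)
  let π' : E' ⟶ W' := FGModuleCat.ofHom (LinearMap.fst A W' I')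
  let ι' : W' ⟶ E' := FGModuleCat.ofHom (LinearMap.inl A W' I')
  -- The summand I is projective, so W ⊕ I → W is stably invertible, and V is a stable isomorphism
  -- because v is.
  have hπ : IsIso ((toStable A).map π) := by
    refine ⟨(toStable A).map ι, ?_, ?_⟩
    · rw [← Functor.map_comp, ← (toStable A).map_id, toStable_map_eq_iff]
      refine ⟨I, FGModuleCat.ofHom (LinearMap.snd A W I), FGModuleCat.ofHom (-LinearMap.inr A W I),
        C.projective, ?_⟩
      refine FGModuleCat.hom_ext (LinearMap.ext ?_)
      rintro ⟨x, y⟩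
      change (x, (0 : I)) - (x, y) = -((0 : W), y)
      simp
    · rw [← Functor.map_comp, ← (toStable A).map_id]
      rfl
  have hπ' : IsIso ((toStable A).map π') := by
    refine ⟨(toStable A).map ι', ?_, ?_⟩
    · rw [← Functor.map_comp, ← (toStable A).map_id, toStable_map_eq_iff]
      refine ⟨I', FGModuleCat.ofHom (LinearMap.snd A W' I'),
        FGModuleCat.ofHom (-LinearMap.inr A W' I'), C'.projective, ?_⟩
      refine FGModuleCat.hom_ext (LinearMap.ext ?_)
      rintro ⟨x, y⟩
      change (x, (0 : I')) - (x, y) = -((0 : W'), y)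
      simp
    · rw [← Functor.map_comp, ← (toStable A).map_id]
      rfl
  let V : E ⟶ E' := FGModuleCat.ofHom
    ((v.hom.hom.comp (LinearMap.fst A W I)).prod (α.hom.hom.coprod β.hom.hom))
  have hV : IsIso ((toStable A).map V) := by
    have h1 : V ≫ π' = π ≫ v := rfl
    have h2 : IsIso ((toStable A).map V ≫ (toStable A).map π') := by
      rw [← Functor.map_comp, h1, Functor.map_comp]
      infer_instance
    exact IsIso.of_isIso_comp_right _ ((toStable A).map π')
  refine C.isShortExact.isIso_map hA C'.isShortExact (v := V) ?_ ?_ hu hV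
  · refine FGModuleCat.hom_ext (LinearMap.ext fun x => ?_)
    change (v.hom.hom (f.hom.hom x), α.hom.hom (f.hom.hom x) + β.hom.hom (h.hom.hom x)) =
      (f'.hom.hom (u.hom.hom x), h'.hom.hom (u.hom.hom x))
    exact Prod.ext (congrArg (fun k : X ⟶ W' => k.hom.hom x) huv)
      (congrArg (fun k : X ⟶ I' => k.hom.hom x) hαβ)
  · refine FGModuleCat.hom_ext (LinearMap.ext ?_)
    rintro ⟨x, y⟩
    have h1 := congrArg (fun k : W ⟶ Y' => k.hom.hom x) hgw
    have h2 := congrArg (fun k : I ⟶ Y' => k.hom.hom y) hjw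
    change w.hom.hom (g.hom.hom x) = g'.hom.hom (v.hom.hom x) - j'.hom.hom (α.hom.hom x) at h1
    change w.hom.hom (j.hom.hom y) = j'.hom.hom (β.hom.hom y) at h2
    change w.hom.hom (g.hom.hom x + -j.hom.hom y) =
      g'.hom.hom (v.hom.hom x) + -j'.hom.hom (α.hom.hom x + β.hom.hom y)
    rw [map_add, map_neg, h1, h2, map_add]
    abel

/-- The maps between cones constructed in `IsCone.exists_map` are stably compatible with ladders. -/
lemma map_comp_eq {X₁ I₁ Y₁ X₁' I₁' Y₁' : FGModuleCat.{u} A}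
    {f₁ : X₁ ⟶ W} {h₁ : X₁ ⟶ I₁} {g₁ : W ⟶ Y₁} {j₁ : I₁ ⟶ Y₁}
    {f₁' : X₁' ⟶ W'} {h₁' : X₁' ⟶ I₁'} {g₁' : W' ⟶ Y₁'} {j₁' : I₁' ⟶ Y₁'}
    (C : IsCone f h g j) (C₁' : IsCone f₁' h₁' g₁' j₁')
    {φ : X ⟶ X₁} {e : I ⟶ I₁} {ψ : Y ⟶ Y₁} (hf : φ ≫ f₁ = f) (he : h ≫ e = φ ≫ h₁)
    (hg : g ≫ ψ = g₁) (hj : j ≫ ψ = e ≫ j₁)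
    {φ' : X' ⟶ X₁'} {e' : I' ⟶ I₁'} {ψ' : Y' ⟶ Y₁'} (he' : h' ≫ e' = φ' ≫ h₁')
    (hg' : g' ≫ ψ' = g₁') (hj' : j' ≫ ψ' = e' ≫ j₁')
    {u : X ⟶ X'} {u₁ : X₁ ⟶ X₁'} {v : W ⟶ W'} (hu : φ ≫ u₁ = u ≫ φ')
    {α : W ⟶ I'} {β : I ⟶ I'} {w : Y ⟶ Y'} (hαβ : f ≫ α + h ≫ β = u ≫ h')
    (hgw : g ≫ w = v ≫ g' - α ≫ j') (hjw : j ≫ w = β ≫ j')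
    {α₁ : W ⟶ I₁'} {β₁ : I₁ ⟶ I₁'} {w₁ : Y₁ ⟶ Y₁'} (hαβ₁ : f₁ ≫ α₁ + h₁ ≫ β₁ = u₁ ≫ h₁')
    (hgw₁ : g₁ ≫ w₁ = v ≫ g₁' - α₁ ≫ j₁') (hjw₁ : j₁ ≫ w₁ = β₁ ≫ j₁') :
    (toStable A).map (ψ ≫ w₁) = (toStable A).map (w ≫ ψ') := by
  -- The two choices of (α, β) differ by a pair of maps to I₁' that glue to γ on the cone Y. The two
  -- composites Y → Y₁' then differ by γ ≫ j₁', which passes through a projective.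
  obtain ⟨γ, hγ₁, hγ₂⟩ := C.exists_desc (α ≫ e' - α₁) (e ≫ β₁ - β ≫ e') (by
    have h1 := congrArg (φ ≫ ·) hαβ₁
    have h2 := congrArg (· ≫ e') hαβ
    simp only [Preadditive.add_comp, Preadditive.comp_add, Category.assoc] at h1 h2
    rw [← Category.assoc φ f₁, hf, ← Category.assoc φ h₁, ← he, ← Category.assoc φ u₁, hu] at h1
    rw [he', ← Category.assoc u φ'] at h2
    rw [← h1] at h2
    simp only [Category.assoc] at h2
    rw [Preadditive.comp_sub, Preadditive.comp_sub, sub_eq_sub_iff_add_eq_add, h2]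
    abel)
  have key : ψ ≫ w₁ = w ≫ ψ' + γ ≫ j₁' := by
    apply C.hom_ext
    · rw [← Category.assoc, hg, hgw₁, Preadditive.comp_add, ← Category.assoc g w, hgw,
        ← Category.assoc g γ, hγ₁]
      simp only [Preadditive.sub_comp, Category.assoc, hg', hj']
      abel
    · rw [← Category.assoc, hj, Category.assoc, hjw₁, Preadditive.comp_add, ← Category.assoc j w,
        hjw, ← Category.assoc j γ, hγ₂]
      simp only [Preadditive.sub_comp, Category.assoc, hj']
      abel
  rw [key, Functor.map_add, toStable_map_comp_eq_zero C₁'.projective, add_zero]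

end IsCone

end Stable

/-! ### Rotations and cosyzygies of sequences: existence and strict functoriality -/

section Sequences

variable {A : Type u} [Ring A]

namespace IsCone

variable {X W I Y : FGModuleCat.{u} A} {f : X ⟶ W} {h : X ⟶ I} {g : W ⟶ Y} {j : I ⟶ Y}

lemma isPushout (C : IsCone f h g j) : IsPushout f h g j := by
  refine IsPushout.of_isColimit' ⟨C.comm⟩ (Limits.PushoutCocone.IsColimit.mk C.comm
    (fun s => (C.exists_desc s.inl s.inr s.condition).choose)
    (fun s => (C.exists_desc s.inl s.inr s.condition).choose_spec.1)
    (fun s => (C.exists_desc s.inl s.inr s.condition).choose_spec.2) fun s m h1 h2 => ?_)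
  have := (C.exists_desc s.inl s.inr s.condition).choose_spec
  exact C.hom_ext (h1.trans this.1.symm) (h2.trans this.2.symm)

lemma of_iso {Y' : FGModuleCat.{u} A} (C : IsCone f h g j) (e : Y ≅ Y') {g' : W ⟶ Y'}
    {j' : I ⟶ Y'} (hg : g ≫ e.hom = g') (hj : j ≫ e.hom = j') : IsCone f h g' j' := by
  subst hg hj
  have hinj : Function.Injective e.hom.hom.hom := (FGModuleCat.isoToLinearEquiv e).injective
  refine ⟨C.projective, by rw [← Category.assoc, C.comm, Category.assoc], C.injective,
    fun y z hyz => C.exact y z (hinj hyz), fun y => ?_⟩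
  obtain ⟨y, rfl⟩ := (FGModuleCat.isoToLinearEquiv e).surjective y
  obtain ⟨w, z, rfl⟩ := C.surjective y
  exact ⟨w, z, (map_add e.hom.hom.hom _ _).symm⟩

end IsCone

lemma exists_isCone {X W I : FGModuleCat.{u} A} (f : X ⟶ W) (h : X ⟶ I)
    (hI : Module.Projective A I) (hh : Function.Injective h.hom.hom) :
    ∃ (Y : FGModuleCat.{u} A) (g : W ⟶ Y) (j : I ⟶ Y), IsCone f h g j := by
  let K : Submodule A (W × I) := LinearMap.range (f.hom.hom.prod (-h.hom.hom))
  refine ⟨FGModuleCat.of A ((W × I) ⧸ K), FGModuleCat.ofHom (K.mkQ.comp (LinearMap.inl A W I)),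
    FGModuleCat.ofHom (K.mkQ.comp (LinearMap.inr A W I)), hI, ?_, ?_, ?_, ?_⟩
  · ext x
    change K.mkQ (f.hom.hom x, 0) = K.mkQ (0, h.hom.hom x)
    rw [← sub_eq_zero, ← map_sub]
    refine (Submodule.Quotient.mk_eq_zero K).2 ⟨x, ?_⟩
    exact Prod.ext (sub_zero _).symm (zero_sub _).symm
  · intro x _ hx
    exact hh (hx.trans (map_zero _).symm)
  · intro y z hyz
    change K.mkQ (y, 0) = K.mkQ (0, z) at hyz
    rw [← sub_eq_zero, ← map_sub] at hyz
    obtain ⟨x, hx⟩ := (Submodule.Quotient.mk_eq_zero K).1 hyz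
    refine ⟨x, (congrArg Prod.fst hx).trans (sub_zero _), neg_injective ?_⟩
    exact (congrArg Prod.snd hx).trans (zero_sub _)
  · intro y
    obtain ⟨⟨w, z⟩, rfl⟩ := K.mkQ_surjective y
    refine ⟨w, z, ?_⟩
    change K.mkQ (w, 0) + K.mkQ (0, z) = _
    rw [← map_add]
    simp

/-- The explicit model of the pushout is a cone, and pushouts are unique up to isomorphism. -/
lemma isCone_of_isPushout {X W I Y : FGModuleCat.{u} A} {f : X ⟶ W} {h : X ⟶ I} {g : W ⟶ Y}
    {j : I ⟶ Y} (hI : Module.Projective A I) (hh : Function.Injective h.hom.hom)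
    (H : IsPushout f h g j) : IsCone f h g j := by
  obtain ⟨Y₀, g₀, j₀, C⟩ := exists_isCone f h hI hh
  exact C.of_iso (C.isPushout.isoIsPushout _ _ H) (by simp) (by simp)

variable {m : ℕ}

/-- A family of stable isomorphisms that is stably compatible with the maps of two sequences. -/
lemma nonempty_stab_iso_of_app {Y Y' : ComposableArrows (FGModuleCat.{u} A) m}
    (f : ∀ i, Y.obj i ⟶ Y'.obj i) (hf : ∀ i, IsIso ((toStable A).map (f i)))
    (w : ∀ (i : ℕ) (hi : i < m), (toStable A).map (Y.map' i (i + 1) ≫ f ⟨i + 1, by lia⟩) =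
      (toStable A).map (f ⟨i, by lia⟩ ≫ Y'.map' i (i + 1))) : Nonempty (stab Y ≅ stab Y') := by
  let φ : ∀ i, (toStable A).obj (Y.obj i) ≅ (toStable A).obj (Y'.obj i) := fun i =>
    asIso ((toStable A).map (f i))
  refine ⟨ComposableArrows.isoMk φ fun i hi => ?_⟩
  have := w i hi
  rw [Functor.map_comp, Functor.map_comp] at this
  exact this

/-- A rotation diagram in which the injective modules need not be envelopes, and the maps to them
need not be monomorphisms. -/
structure WeakRotation (X Y : ComposableArrows (FGModuleCat.{u} A) m) where
  /-- The injective modules. -/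
  I : Fin m → FGModuleCat.{u} A
  /-- The maps to the injective modules. -/
  h : ∀ k : Fin m, X.obj k.castSucc ⟶ I k
  /-- The first object of the rotation. -/
  first : X.obj (Fin.last m) ≅ Y.obj 0
  /-- The maps from the injective modules. -/
  j : ∀ k : Fin m, I k ⟶ Y.obj k.succ
  isCone : ∀ k : Fin m, IsCone (X.map (homOfLE (Fin.le_last k.castSucc)) ≫ first.hom) (h k)
    (Y.map (homOfLE (Fin.zero_le k.succ))) (j k)
  /-- The maps between the injective modules. -/
  e : ∀ (k : ℕ) (hk : k + 1 < m), I ⟨k, by lia⟩ ⟶ I ⟨k + 1, hk⟩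
  h_e : ∀ (k : ℕ) (hk : k + 1 < m),
    h ⟨k, by lia⟩ ≫ e k hk = X.map' k (k + 1) ≫ h ⟨k + 1, hk⟩
  j_map : ∀ (k : ℕ) (hk : k + 1 < m),
    j ⟨k, by lia⟩ ≫ Y.map' (k + 1) (k + 2) = e k hk ≫ j ⟨k + 1, hk⟩

/-- A rotation diagram is a weak rotation diagram. -/
def RotationDiagram.toWeakRotation (hA : IsFrobenius A)
    {X Y : ComposableArrows (FGModuleCat.{u} A) m} (D : RotationDiagram X Y) :
    WeakRotation X Y where
  I := D.I
  h := D.h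
  first := D.first
  j := D.j
  isCone k := by
    have hI := (hA.projective_iff _).2 (D.isInjectiveEnvelope k).injective_module
    have hh := (D.isInjectiveEnvelope k).injective_hom
    have C := isCone_of_isPushout hI hh (D.isPushout k)
    refine ⟨hI, ?_, fun x _ hx => hh (hx.trans (map_zero _).symm), ?_, ?_⟩
    · rw [Category.assoc]
      exact C.comm
    · intro y z hyz
      obtain ⟨y, rfl⟩ := (FGModuleCat.isoToLinearEquiv D.first).surjective y
      obtain ⟨x, rfl, rfl⟩ := C.exact y z hyz
      exact ⟨x, rfl, rfl⟩
    · intro y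
      obtain ⟨w, z, rfl⟩ := C.surjective y
      exact ⟨D.first.hom.hom.hom w, z, rfl⟩
  e := D.e
  h_e := D.h_e
  j_map := D.j_map

/-- A strict morphism of sequences that is stably invertible in every degree induces a stable
isomorphism of rotations. -/
theorem WeakRotation.nonempty_stab_iso_of_hom (hA : IsFrobenius A)
    {X Y X' Y' : ComposableArrows (FGModuleCat.{u} A) m} (D : WeakRotation X Y)
    (D' : WeakRotation X' Y') (p : X ⟶ X') (hp : ∀ k, IsIso ((toStable A).map (p.app k))) :
    Nonempty (stab Y ≅ stab Y') := by
  let v : Y.obj 0 ⟶ Y'.obj 0 := D.first.inv ≫ p.app (Fin.last m) ≫ D'.first.hom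
  have hv : IsIso ((toStable A).map v) := by
    have := hp (Fin.last m)
    rw [Functor.map_comp, Functor.map_comp]
    infer_instance
  have huv : ∀ k : Fin m, (X.map (homOfLE (Fin.le_last k.castSucc)) ≫ D.first.hom) ≫ v =
      p.app k.castSucc ≫ X'.map (homOfLE (Fin.le_last k.castSucc)) ≫ D'.first.hom := by
    intro k
    simp [v]
  choose α β w hαβ hgw hjw hw using fun k : Fin m =>
    (D.isCone k).exists_map hA (D'.isCone k) (huv k) (hp k.castSucc) hv
  let φ : ∀ i : Fin (m + 1), Y.obj i ⟶ Y'.obj i := fun i =>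
    match i with
    | ⟨0, _⟩ => v
    | ⟨k + 1, hk⟩ => w ⟨k, by lia⟩
  refine nonempty_stab_iso_of_app φ ?_ ?_
  · rintro ⟨_ | k, hk⟩
    · exact hv
    · exact hw ⟨k, by lia⟩
  intro i hi
  rcases i with _ | i
  -- The first square involves the correction term α ≫ j', which is stably zero.
  · refine (congrArg (toStable A).map (hgw ⟨0, hi⟩)).trans ?_
    rw [Functor.map_sub, toStable_map_comp_eq_zero (D'.isCone ⟨0, hi⟩).projective, sub_zero]
    rfl
  · change (toStable A).map (Y.map' (i + 1) (i + 2) ≫ w ⟨i + 1, hi⟩) =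
      (toStable A).map (w ⟨i, by lia⟩ ≫ Y'.map' (i + 1) (i + 2))
    refine (D.isCone ⟨i, by lia⟩).map_comp_eq (D'.isCone ⟨i + 1, hi⟩)
      (φ := X.map' i (i + 1)) (e := D.e i hi) (φ' := X'.map' i (i + 1)) (e' := D'.e i hi)
      ?_ (D.h_e i hi) ?_ (D.j_map i hi) (D'.h_e i hi) ?_ (D'.j_map i hi)
      (p.naturality _) (hαβ _) (hgw _) (hjw _) (hαβ _) (hgw _) (hjw _)
    · refine (Category.assoc _ _ _).symm.trans (congrArg (· ≫ D.first.hom) ?_)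
      exact (X.map_comp _ _).symm
    · exact (Y.map_comp _ _).symm
    · exact (Y'.map_comp _ _).symm

/-- A cosyzygy diagram in which the injective modules need not be envelopes. -/
structure WeakCosyzygy (X Z : ComposableArrows (FGModuleCat.{u} A) m) where
  /-- The injective modules. -/
  I : ComposableArrows (FGModuleCat.{u} A) m
  /-- The inclusions into the injective modules. -/
  h : X ⟶ I
  /-- The projections onto the cosyzygies. -/
  p : I ⟶ Z
  projective : ∀ k, Module.Projective A (I.obj k)
  isShortExact : ∀ k, IsShortExact (h.app k) (p.app k)

/-- A cosyzygy diagram is a weak cosyzygy diagram. -/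
def CosyzygyDiagram.toWeakCosyzygy (hA : IsFrobenius A)
    {X Z : ComposableArrows (FGModuleCat.{u} A) m} (D : CosyzygyDiagram X Z) :
    WeakCosyzygy X Z where
  I := D.I
  h := D.h
  p := D.p
  projective k := (hA.projective_iff _).2 (D.isInjectiveEnvelope k).injective_module
  isShortExact k := ⟨(D.isInjectiveEnvelope k).injective_hom, D.exact k, D.surjective k⟩

/-- A cosyzygy is the cone of X → 0, so the functoriality of cones covers cosyzygies too. -/
lemma IsShortExact.isCone {X I Z : FGModuleCat.{u} A} {i : X ⟶ I} {p : I ⟶ Z}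
    (S : IsShortExact i p) (hI : Module.Projective A I) :
    IsCone (0 : X ⟶ FGModuleCat.of A PUnit.{u + 1}) i 0 p where
  projective := hI
  comm := by rw [S.comp_eq_zero, Limits.comp_zero]
  injective x _ hx := S.injective (hx.trans (map_zero _).symm)
  exact y z hyz := by
    obtain ⟨x, hx⟩ := (S.exact z).1 hyz.symm
    exact ⟨x, Subsingleton.elim (α := PUnit) _ _, hx⟩
  surjective y := by
    obtain ⟨z, rfl⟩ := S.surjective y
    exact ⟨PUnit.unit, z, zero_add _⟩

/-- A strict morphism of sequences that is stably invertible in every degree induces a stable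
isomorphism of cosyzygies. -/
theorem WeakCosyzygy.nonempty_stab_iso_of_hom (hA : IsFrobenius A)
    {X Z X' Z' : ComposableArrows (FGModuleCat.{u} A) m} (D : WeakCosyzygy X Z)
    (D' : WeakCosyzygy X' Z') (p : X ⟶ X') (hp : ∀ k, IsIso ((toStable A).map (p.app k))) :
    Nonempty (stab Z ≅ stab Z') := by
  have C := fun k => (D.isShortExact k).isCone (D.projective k)
  have C' := fun k => (D'.isShortExact k).isCone (D'.projective k)
  choose α β w hαβ hgw hjw hw using fun k =>
    (C k).exists_map hA (C' k) (u := p.app k) (v := 𝟙 _) (by simp) (hp k) inferInstance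
  refine nonempty_stab_iso_of_app w hw fun i hi => ?_
  exact (C _).map_comp_eq (C' _)
    (φ := X.map' i (i + 1)) (e := D.I.map' i (i + 1)) (φ' := X'.map' i (i + 1))
    (e' := D'.I.map' i (i + 1))
    (by simp) (D.h.naturality _).symm (by simp) (D.p.naturality _).symm (D'.h.naturality _).symm
    (by simp) (D'.p.naturality _).symm
    (p.naturality _) (hαβ _) (hgw _) (hjw _) (hαβ _) (hgw _) (hjw _)

/-- Every sequence of modules has a rotation. -/
theorem exists_rotationDiagram (hA : IsFrobenius A)
    (X : ComposableArrows (FGModuleCat.{u} A) m) :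
    ∃ Y : ComposableArrows (FGModuleCat.{u} A) m, Nonempty (RotationDiagram X Y) := by
  choose I h hI using fun k : Fin m => hA.exists_envelope (X.obj k.castSucc)
  have hP := fun k => (hA.projective_iff _).2 (hI k).injective_module
  choose Y g j C using fun k : Fin m => exists_isCone (X.map (homOfLE (Fin.le_last k.castSucc)))
    (h k) (hP k) (hI k).injective_hom
  have hψ : ∀ (k : ℕ) (hk : k + 1 < m), ∃ (e : I ⟨k, by lia⟩ ⟶ I ⟨k + 1, hk⟩)
      (ψ : Y ⟨k, by lia⟩ ⟶ Y ⟨k + 1, hk⟩),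
      h ⟨k, by lia⟩ ≫ e = X.map' k (k + 1) ≫ h ⟨k + 1, hk⟩ ∧
      g ⟨k, by lia⟩ ≫ ψ = g ⟨k + 1, hk⟩ ∧ j ⟨k, by lia⟩ ≫ ψ = e ≫ j ⟨k + 1, hk⟩ := by
    intro k hk
    obtain ⟨e, he⟩ := hA.exists_extension (hP ⟨k + 1, hk⟩) (h ⟨k, by lia⟩)
      (hI ⟨k, by lia⟩).injective_hom (X.map' k (k + 1) ≫ h ⟨k + 1, hk⟩)
    obtain ⟨ψ, h1, h2⟩ := (C ⟨k, by lia⟩).exists_desc (g ⟨k + 1, hk⟩) (e ≫ j ⟨k + 1, hk⟩) (by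
      rw [← Category.assoc, he, Category.assoc, ← (C ⟨k + 1, hk⟩).comm, ← Category.assoc,
        ← Functor.map_comp]
      rfl)
    exact ⟨e, ψ, he, h1, h2⟩
  choose e ψ he hgψ hjψ using hψ
  -- For m = 0 there are no pushouts and the rotation is X itself. Otherwise the chain of pushouts
  -- is nonempty and X₁ is put in front of it.
  rcases m with _ | m
  · exact ⟨X, ⟨{
      I := I, h := h, isInjectiveEnvelope := hI, first := Iso.refl _
      j := fun k => k.elim0, isPushout := fun k => k.elim0
      e := fun k hk => absurd hk (by lia), h_e := fun k hk => absurd hk (by lia)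
      j_map := fun k hk => absurd hk (by lia) }⟩⟩
  · let F : ComposableArrows (FGModuleCat.{u} A) m :=
      ComposableArrows.mkOfObjOfMapSucc Y fun k => ψ k.1 (by lia)
    let G : ComposableArrows (FGModuleCat.{u} A) (m + 1) := F.precomp (g 0)
    have hF : ∀ (k : ℕ) (hk : k < m), F.map' k (k + 1) = ψ k (by lia) := fun k hk =>
      ComposableArrows.mkOfObjOfMapSucc_map_succ Y (fun k => ψ k.1 (by lia)) k hk
    have hG : ∀ (k : ℕ) (hk : k < m + 1), G.map' 0 (k + 1) = g ⟨k, hk⟩ := by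
      intro k
      induction k with
      | zero => intro hk; rfl
      | succ k ih =>
        intro hk
        rw [G.map'_comp 0 (k + 1) (k + 2), ih (by lia), ← hgψ k hk, ← hF k (by lia)]
        rfl
    exact ⟨G, ⟨{
      I := I, h := h, isInjectiveEnvelope := hI, first := Iso.refl _
      j := j
      isPushout := fun k => by
        have h1 : (Iso.refl (X.obj (Fin.last (m + 1)))).hom ≫ G.map (homOfLE (Fin.zero_le k.succ)) =
            g k := (Category.id_comp _).trans (hG k.1 k.2)
        have := (C k).isPushout
        rw [← h1] at this
        exact this
      e := e, h_e := he
      j_map := fun k hk => by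
        have h1 : G.map' (k + 1) (k + 2) = ψ k hk := hF k (by lia)
        exact (congrArg (j ⟨k, by lia⟩ ≫ ·) h1).trans (hjψ k hk) }⟩⟩

/-- Every sequence of modules has a cosyzygy. -/
theorem exists_cosyzygyDiagram (hA : IsFrobenius A)
    (X : ComposableArrows (FGModuleCat.{u} A) m) :
    ∃ Z : ComposableArrows (FGModuleCat.{u} A) m, Nonempty (CosyzygyDiagram X Z) := by
  choose I h hI using fun k : Fin (m + 1) => hA.exists_envelope (X.obj k)
  have hP := fun k => (hA.projective_iff _).2 (hI k).injective_module
  choose e he using fun k : Fin m => hA.exists_extension (hP k.succ) (h k.castSucc)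
    (hI k.castSucc).injective_hom (X.map (homOfLE k.castSucc_lt_succ.le) ≫ h k.succ)
  let J : ComposableArrows (FGModuleCat.{u} A) m := ComposableArrows.mkOfObjOfMapSucc I e
  let η : X ⟶ J := ComposableArrows.homMk h fun k hk => by
    rw [ComposableArrows.mkOfObjOfMapSucc_map_succ I e k hk]
    exact (he ⟨k, hk⟩).symm
  let K : ∀ k, Submodule A (J.obj k) := fun k => LinearMap.range (η.app k).hom.hom
  have hK : ∀ {k l} (f : k ⟶ l), K k ≤ (K l).comap (J.map f).hom.hom := by
    rintro k l f _ ⟨x, rfl⟩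
    exact ⟨(X.map f).hom.hom x, congrArg (fun t : X.obj k ⟶ J.obj l => t.hom.hom x)
      (η.naturality f)⟩
  let Z : ComposableArrows (FGModuleCat.{u} A) m :=
    { obj := fun k => FGModuleCat.of A (J.obj k ⧸ K k)
      map := fun {k l} f => FGModuleCat.ofHom ((K k).mapQ (K l) (J.map f).hom.hom (hK f))
      map_id := fun k => by
        refine FGModuleCat.hom_ext (LinearMap.ext fun y => ?_)
        obtain ⟨y, rfl⟩ := (K k).mkQ_surjective y
        change (K k).mkQ ((J.map (𝟙 k)).hom.hom y) = (K k).mkQ y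
        rw [J.map_id]
        rfl
      map_comp := fun {k l r} f g => by
        refine FGModuleCat.hom_ext (LinearMap.ext fun y => ?_)
        obtain ⟨y, rfl⟩ := (K k).mkQ_surjective y
        change (K r).mkQ ((J.map (f ≫ g)).hom.hom y) =
          (K r).mkQ ((J.map g).hom.hom ((J.map f).hom.hom y))
        rw [J.map_comp]
        rfl }
  exact ⟨Z, ⟨{
    I := J, h := η
    p := { app := fun k => FGModuleCat.ofHom (K k).mkQ, naturality := fun k l f => rfl }
    isInjectiveEnvelope := hI
    exact := fun k => LinearMap.exact_map_mkQ_range _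
    surjective := fun k => (K k).mkQ_surjective }⟩⟩

end Sequences

/-! ### Representing stable isomorphisms by roofs; independence of choices -/

section Roofs

variable {A : Type u} [Ring A] {m : ℕ}

/-- A module with a stable isomorphism to `X` and a homomorphism to `X'` that stably lifts a
given homomorphism `f`. -/
structure StableRoof {X X' : FGModuleCat.{u} A} (f : X ⟶ X') where
  /-- The top of the roof. -/
  T : FGModuleCat.{u} A
  /-- The left leg. -/
  p : T ⟶ X
  /-- The right leg. -/
  q : T ⟶ X'
  isIso_p : IsIso ((toStable A).map p)
  map_q : (toStable A).map q = (toStable A).map (p ≫ f)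

/-- The new top is Y ⊕ P ⊕ J. The summand P absorbs the map through a projective by which the
right-hand square fails to commute, and the envelope J of the old top makes the transition map t
injective. Neither changes the stable class. -/
lemma StableRoof.exists_succ (hA : IsFrobenius A) {X X' Y Y' : FGModuleCat.{u} A} {f : X ⟶ X'}
    {g : Y ⟶ Y'} {φ : X ⟶ Y} {φ' : X' ⟶ Y'}
    (h : (toStable A).map (φ ≫ g) = (toStable A).map (f ≫ φ')) (s : StableRoof f) :
    ∃ (s' : StableRoof g) (t : s.T ⟶ s'.T), Function.Injective t.hom.hom ∧
      t ≫ s'.p = s.p ≫ φ ∧ t ≫ s'.q = s.q ≫ φ' := by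
  have h1 : (toStable A).map (s.p ≫ φ ≫ g) = (toStable A).map (s.q ≫ φ') := by
    rw [Functor.map_comp, h, ← Functor.map_comp, ← Category.assoc, Functor.map_comp, ← s.map_q,
      ← Functor.map_comp]
  obtain ⟨P, a, b, hP, hab⟩ := (toStable_map_eq_iff _ _).1 h1
  obtain ⟨J, i, hi⟩ := hA.exists_envelope s.T
  have hJ : Module.Projective A J := (hA.projective_iff J).2 hi.injective_module
  have hPJ : Module.Projective A (P × J) := inferInstance
  let T' := FGModuleCat.of A (Y × (P × J))
  let p' : T' ⟶ Y := FGModuleCat.ofHom (LinearMap.fst A Y (P × J))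
  let c : T' ⟶ P := FGModuleCat.ofHom ((LinearMap.fst A P J).comp (LinearMap.snd A Y (P × J)))
  let t : s.T ⟶ T' := FGModuleCat.ofHom
    ((s.p ≫ φ).hom.hom.prod (a.hom.hom.prod i.hom.hom))
  have hp' : IsIso ((toStable A).map p') := by
    refine ⟨(toStable A).map (FGModuleCat.ofHom (LinearMap.inl A Y (P × J))), ?_, ?_⟩
    · rw [← Functor.map_comp, ← (toStable A).map_id, toStable_map_eq_iff]
      refine ⟨FGModuleCat.of A (P × J), FGModuleCat.ofHom (LinearMap.snd A Y (P × J)),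
        FGModuleCat.ofHom (-LinearMap.inr A Y (P × J)), hPJ, ?_⟩
      refine FGModuleCat.hom_ext (LinearMap.ext ?_)
      rintro ⟨x, y⟩
      change (x, (0 : P × J)) - (x, y) = -((0 : Y), y)
      simp
    · rw [← Functor.map_comp, ← (toStable A).map_id]
      rfl
  refine ⟨⟨T', p', p' ≫ g - c ≫ b, hp', ?_⟩, t, ?_, rfl, ?_⟩
  · rw [Functor.map_sub, toStable_map_comp_eq_zero hP, sub_zero]
  · intro x y hxy
    exact hi.injective_hom (congrArg (fun z : Y × (P × J) => z.2.2) hxy)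
  · have h2 : t ≫ p' ≫ g = s.p ≫ φ ≫ g := rfl
    have h3 : t ≫ c ≫ b = a ≫ b := rfl
    rw [Preadditive.comp_sub, h2, h3, ← hab]
    abel

/-- Every stable isomorphism of sequences is represented by a roof of strict morphisms, whose top
is a sequence of monomorphisms. -/
theorem exists_roof (hA : IsFrobenius A) {X X' : ComposableArrows (FGModuleCat.{u} A) m}
    (ε : stab X ≅ stab X') :
    ∃ (T : ComposableArrows (FGModuleCat.{u} A) m) (p : T ⟶ X) (q : T ⟶ X'),
      (∀ k, IsIso ((toStable A).map (p.app k))) ∧ (∀ k, IsIso ((toStable A).map (q.app k))) ∧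
      ∀ (k : ℕ) (hk : k < m), Function.Injective (T.map' k (k + 1)).hom.hom := by
  have hf : ∀ k, ∃ f : X.obj k ⟶ X'.obj k, (toStable A).map f = ε.hom.app k := fun k =>
    (toStable A).map_surjective (ε.hom.app k)
  choose f hf using hf
  have hnat : ∀ k : Fin m, (toStable A).map (X.map (homOfLE k.castSucc_lt_succ.le) ≫ f k.succ) =
      (toStable A).map (f k.castSucc ≫ X'.map (homOfLE k.castSucc_lt_succ.le)) := by
    intro k
    rw [Functor.map_comp, Functor.map_comp, hf, hf]
    exact ε.hom.naturality _
  choose step t ht using fun (k : Fin m) (s : StableRoof (f k.castSucc)) =>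
    s.exists_succ hA (hnat k)
  let s₀ : StableRoof (f 0) := ⟨X.obj 0, 𝟙 _, f 0, inferInstance, by simp⟩
  let s : ∀ k, StableRoof (f k) := Fin.induction s₀ step
  have hs : ∀ k : Fin m, ∃ t : (s k.castSucc).T ⟶ (s k.succ).T, Function.Injective t.hom.hom ∧
      t ≫ (s k.succ).p = (s k.castSucc).p ≫ X.map (homOfLE k.castSucc_lt_succ.le) ∧
      t ≫ (s k.succ).q = (s k.castSucc).q ≫ X'.map (homOfLE k.castSucc_lt_succ.le) := by
    intro k
    have h1 : s k.succ = step k (s k.castSucc) := Fin.induction_succ _ _ _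
    rw [h1]
    exact ⟨t k _, ht k _⟩
  choose τ hτ hτp hτq using hs
  let T : ComposableArrows (FGModuleCat.{u} A) m :=
    ComposableArrows.mkOfObjOfMapSucc (fun k => (s k).T) τ
  have hT : ∀ (k : ℕ) (hk : k < m), T.map' k (k + 1) = τ ⟨k, hk⟩ := fun k hk =>
    ComposableArrows.mkOfObjOfMapSucc_map_succ (fun k => (s k).T) τ k hk
  refine ⟨T, ComposableArrows.homMk (fun k => (s k).p) fun k hk => ?_,
    ComposableArrows.homMk (fun k => (s k).q) fun k hk => ?_, fun k => (s k).isIso_p, fun k => ?_,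
    fun k hk => ?_⟩
  · rw [hT k hk]
    exact hτp ⟨k, hk⟩
  · rw [hT k hk]
    exact hτq ⟨k, hk⟩
  · have := (s k).isIso_p
    have : IsIso ((toStable A).map (f k)) := by
      rw [hf]
      exact inferInstanceAs (IsIso (ε.hom.app k))
    change IsIso ((toStable A).map (s k).q)
    rw [(s k).map_q, Functor.map_comp]
    infer_instance
  · rw [hT k hk]
    exact hτ ⟨k, hk⟩

/-- Rotations are invariant under isomorphisms of sequences in the stable category. -/
theorem WeakRotation.nonempty_stab_iso (hA : IsFrobenius A)
    {X Y X' Y' : ComposableArrows (FGModuleCat.{u} A) m} (D : WeakRotation X Y)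
    (D' : WeakRotation X' Y') (ε : stab X ≅ stab X') : Nonempty (stab Y ≅ stab Y') := by
  -- Both rotations are compared with a rotation of the top of the roof, along the two strict legs.
  obtain ⟨T, p, q, hp, hq, -⟩ := exists_roof hA ε
  obtain ⟨S, ⟨E⟩⟩ := exists_rotationDiagram hA T
  obtain ⟨e₁⟩ := (E.toWeakRotation hA).nonempty_stab_iso_of_hom hA D p hp
  obtain ⟨e₂⟩ := (E.toWeakRotation hA).nonempty_stab_iso_of_hom hA D' q hq
  exact ⟨e₁.symm ≪≫ e₂⟩

/-- Cosyzygies are invariant under isomorphisms of sequences in the stable category. -/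
theorem WeakCosyzygy.nonempty_stab_iso (hA : IsFrobenius A)
    {X Y X' Y' : ComposableArrows (FGModuleCat.{u} A) m} (D : WeakCosyzygy X Y)
    (D' : WeakCosyzygy X' Y') (ε : stab X ≅ stab X') : Nonempty (stab Y ≅ stab Y') := by
  obtain ⟨T, p, q, hp, hq, -⟩ := exists_roof hA ε
  obtain ⟨S, ⟨E⟩⟩ := exists_cosyzygyDiagram hA T
  obtain ⟨e₁⟩ := (E.toWeakCosyzygy hA).nonempty_stab_iso_of_hom hA D p hp
  obtain ⟨e₂⟩ := (E.toWeakCosyzygy hA).nonempty_stab_iso_of_hom hA D' q hq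
  exact ⟨e₁.symm ≪≫ e₂⟩

lemma exists_isIterate_isRotation (hA : IsFrobenius A)
    (X : ComposableArrows (FGModuleCat.{u} A) m) (k : ℕ) :
    ∃ Y : ComposableArrows (FGModuleCat.{u} A) m, IsIterate IsRotation k (stab X) (stab Y) := by
  induction k with
  | zero => exact ⟨X, ⟨Iso.refl _⟩⟩
  | succ k ih =>
    obtain ⟨M, hM⟩ := ih
    obtain ⟨Y, hY⟩ := exists_rotationDiagram hA M
    exact ⟨Y, stab M, hM, M, Y, ⟨Iso.refl _⟩, hY, ⟨Iso.refl _⟩⟩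

lemma exists_isIterate_isCosyzygy (hA : IsFrobenius A)
    (X : ComposableArrows (FGModuleCat.{u} A) m) (k : ℕ) :
    ∃ Y : ComposableArrows (FGModuleCat.{u} A) m, IsIterate IsCosyzygy k (stab X) (stab Y) := by
  induction k with
  | zero => exact ⟨X, ⟨Iso.refl _⟩⟩
  | succ k ih =>
    obtain ⟨M, hM⟩ := ih
    obtain ⟨Y, hY⟩ := exists_cosyzygyDiagram hA M
    exact ⟨Y, stab M, hM, M, Y, ⟨Iso.refl _⟩, hY, ⟨Iso.refl _⟩⟩

/-- Iterated rotations can be computed by weak rotation diagrams. -/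
lemma nonempty_iso_of_isIterate_isRotation (hA : IsFrobenius A)
    {L : ℕ → ComposableArrows (FGModuleCat.{u} A) m}
    (D : ∀ k, Nonempty (WeakRotation (L k) (L (k + 1))))
    {X : ComposableArrows (StableCat A) m} (ε : Nonempty (X ≅ stab (L 0))) (k : ℕ)
    {Y : ComposableArrows (StableCat A) m} (h : IsIterate IsRotation k X Y) :
    Nonempty (Y ≅ stab (L k)) := by
  induction k generalizing Y with
  | zero =>
    obtain ⟨e⟩ := h
    obtain ⟨ε⟩ := ε
    exact ⟨e.symm ≪≫ ε⟩
  | succ k ih =>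
    obtain ⟨S, hS, M, N, ⟨e₁⟩, ⟨E⟩, ⟨e₂⟩⟩ := h
    obtain ⟨e₃⟩ := ih hS
    obtain ⟨D⟩ := D k
    obtain ⟨e₄⟩ := (E.toWeakRotation hA).nonempty_stab_iso hA D (e₁ ≪≫ e₃)
    exact ⟨e₂.symm ≪≫ e₄⟩

/-- Iterated cosyzygies can be computed by weak cosyzygy diagrams. -/
lemma nonempty_iso_of_isIterate_isCosyzygy (hA : IsFrobenius A)
    {L : ℕ → ComposableArrows (FGModuleCat.{u} A) m}
    (D : ∀ k, Nonempty (WeakCosyzygy (L k) (L (k + 1))))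
    {X : ComposableArrows (StableCat A) m} (ε : Nonempty (X ≅ stab (L 0))) (k : ℕ)
    {Y : ComposableArrows (StableCat A) m} (h : IsIterate IsCosyzygy k X Y) :
    Nonempty (Y ≅ stab (L k)) := by
  induction k generalizing Y with
  | zero =>
    obtain ⟨e⟩ := h
    obtain ⟨ε⟩ := ε
    exact ⟨e.symm ≪≫ ε⟩
  | succ k ih =>
    obtain ⟨S, hS, M, N, ⟨e₁⟩, ⟨E⟩, ⟨e₂⟩⟩ := h
    obtain ⟨e₃⟩ := ih hS
    obtain ⟨D⟩ := D k
    obtain ⟨e₄⟩ := (E.toWeakCosyzygy hA).nonempty_stab_iso hA D (e₁ ≪≫ e₃)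
    exact ⟨e₂.symm ≪≫ e₄⟩

end Roofs

/-! ### The strip of bicartesian rectangles -/

section Strips

variable {A : Type u} [Ring A]

/-- A projective-injective module with a filtration that starts in degree `a` and is exhausted in
degree `a + m + 2`. -/
structure FilteredModule (A : Type u) [Ring A] (m a : ℕ) where
  /-- The module. -/
  I : FGModuleCat.{u} A
  /-- The filtration. -/
  G : ℕ → Submodule A I
  projective : Module.Projective A I
  mono : Monotone G
  bot : G a = ⊥
  top : ∀ b, a + m + 2 ≤ b → G b = ⊤

/-- The next ambient module is an injective envelope of the quotient by the first step, filtered by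
the images of the old steps. -/
lemma FilteredModule.exists_succ (hA : IsFrobenius A) {m a : ℕ} (F : FilteredModule A m a) :
    ∃ (F' : FilteredModule A m (a + 1)) (θ : F.I ⟶ F'.I),
      LinearMap.ker θ.hom.hom = F.G (a + 1) ∧
      ∀ b, b ≤ a + m + 2 → (F.G b).map θ.hom.hom = F'.G b := by
  obtain ⟨J, h, hh⟩ := hA.exists_envelope (FGModuleCat.of A (F.I ⧸ F.G (a + 1)))
  let θ : F.I ⟶ J := FGModuleCat.ofHom (h.hom.hom.comp (F.G (a + 1)).mkQ)
  have hker : LinearMap.ker θ.hom.hom = F.G (a + 1) := by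
    ext x
    change h.hom.hom ((F.G (a + 1)).mkQ x) = 0 ↔ _
    rw [map_eq_zero_iff _ hh.injective_hom]
    exact Submodule.Quotient.mk_eq_zero _
  -- The bound a + m + 3 is (a + 1) + m + 2. In degree a + m + 2 the step is the image of the whole
  -- old module, which may be proper in J.
  refine ⟨⟨J, fun b => if a + m + 3 ≤ b then ⊤ else (F.G b).map θ.hom.hom,
    (hA.projective_iff J).2 hh.injective_module, ?_, ?_, ?_⟩, θ, hker, fun b hb => ?_⟩
  · intro b c hbc
    dsimp only
    split_ifs with h1 h2
    · exact le_rfl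
    · lia
    · exact le_top
    · exact Submodule.map_mono (F.mono hbc)
  · rw [if_neg (by lia), ← hker]
    exact LinearMap.le_ker_iff_map.1 le_rfl
  · intro b hb
    rw [if_pos (by lia)]
  · exact (if_neg (by lia)).symm

/-- A sequence of filtered projective modules, in which each one contains the quotient of the
previous one by the first step of its filtration. The modules `G a b` form a strip in which all
squares are bicartesian. -/
structure Strip (A : Type u) [Ring A] (m : ℕ) where
  /-- The filtered modules. -/
  F : ∀ a, FilteredModule A m a
  /-- The maps between them. -/
  θ : ∀ a, (F a).I ⟶ (F (a + 1)).I
  ker_θ : ∀ a, LinearMap.ker (θ a).hom.hom = (F a).G (a + 1)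
  map_θ : ∀ a b, b ≤ a + m + 2 → ((F a).G b).map (θ a).hom.hom = (F (a + 1)).G b

lemma FilteredModule.exists_strip (hA : IsFrobenius A) {m : ℕ} (F : FilteredModule A m 0) :
    ∃ S : Strip A m, S.F 0 = F := by
  choose next θ hker hmap using fun a (F : FilteredModule A m a) => F.exists_succ hA
  let s : ∀ a, FilteredModule A m a := fun a => Nat.rec F next a
  exact ⟨⟨s, fun a => θ a (s a), fun a => hker a (s a), fun a => hmap a (s a)⟩, rfl⟩

namespace Strip

variable {m : ℕ} (S : Strip A m)

/-- The composite maps of the ambient modules. -/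
noncomputable def ambient : ℕ ⥤ FGModuleCat.{u} A := Functor.ofSequence S.θ

/-- The composite maps, as linear maps. -/
noncomputable def T {a a' : ℕ} (h : a ≤ a') : (S.F a).I →ₗ[A] (S.F a').I :=
  (S.ambient.map (homOfLE h)).hom.hom

lemma T_self (a : ℕ) (x : (S.F a).I) : S.T le_rfl x = x := by
  change (S.ambient.map (𝟙 a)).hom.hom x = x
  rw [S.ambient.map_id]
  rfl

lemma T_comp {a b c : ℕ} (h : a ≤ b) (h' : b ≤ c) (x : (S.F a).I) :
    S.T h' (S.T h x) = S.T (h.trans h') x := by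
  change _ = (S.ambient.map (homOfLE h ≫ homOfLE h')).hom.hom x
  rw [S.ambient.map_comp]
  rfl

lemma T_succ (a : ℕ) : S.T (Nat.le_succ a) = (S.θ a).hom.hom := by
  have : S.ambient.map (homOfLE (Nat.le_add_right a 1)) = S.θ a :=
    Functor.ofSequence_map_homOfLE_succ S.θ a
  exact congrArg (fun f : (S.F a).I ⟶ (S.F (a + 1)).I => f.hom.hom) this

lemma T_eq_comp_θ {a a' : ℕ} (h : a ≤ a') :
    S.T (h.trans (Nat.le_succ a')) = (S.θ a').hom.hom.comp (S.T h) := by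
  ext x
  rw [← S.T_comp h (Nat.le_succ a'), S.T_succ]
  rfl

lemma map_T {a a' b : ℕ} (h : a ≤ a') (hb : b ≤ a + m + 2) :
    ((S.F a).G b).map (S.T h) = (S.F a').G b := by
  induction a', h using Nat.le_induction with
  | base =>
    have : S.T (le_refl a) = LinearMap.id := LinearMap.ext (S.T_self a)
    rw [this, Submodule.map_id]
  | succ a' h ih =>
    rw [S.T_eq_comp_θ h, Submodule.map_comp, ih, S.map_θ a' b (by lia)]

lemma T_mem {a a' b b' : ℕ} (h : a ≤ a') (hb : b ≤ b') {x : (S.F a).I} (hx : x ∈ (S.F a).G b) :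
    S.T h x ∈ (S.F a').G b' := by
  induction a', h using Nat.le_induction with
  | base =>
    rw [S.T_self]
    exact (S.F a).mono hb hx
  | succ a' h ih =>
    by_cases h' : b' ≤ a' + m + 2
    · rw [S.T_eq_comp_θ h, ← S.map_θ a' b' h']
      exact Submodule.mem_map_of_mem ih
    · rw [(S.F (a' + 1)).top b' (by lia)]
      exact Submodule.mem_top

/-- Inductively, the kernel of one more map pulls back to G a (a' + 1) + ker T, and by induction ker
T is the smaller step G a a'. This is the source of the exactness of the strip. -/
lemma ker_T {a a' : ℕ} (h : a ≤ a') (h' : a' ≤ a + m + 2) :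
    LinearMap.ker (S.T h) = (S.F a).G a' := by
  induction a', h using Nat.le_induction with
  | base =>
    rw [(S.F a).bot, LinearMap.ker_eq_bot']
    intro x hx
    rwa [S.T_self] at hx
  | succ a' h ih =>
    rw [S.T_eq_comp_θ h, LinearMap.ker_comp, S.ker_θ, ← S.map_T h h', Submodule.comap_map_eq,
      ih (by lia), sup_eq_left]
    exact (S.F a).mono (Nat.le_succ a')

variable [IsNoetherianRing A]

/-- The modules in a strip. -/
abbrev X (a b : ℕ) : FGModuleCat.{u} A := FGModuleCat.of A ((S.F a).G b)

/-- The maps in a strip. -/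
noncomputable def map {a b a' b' : ℕ} (ha : a ≤ a') (hb : b ≤ b') : S.X a b ⟶ S.X a' b' :=
  FGModuleCat.ofHom ((S.T ha).restrict fun _ hx => S.T_mem ha hb hx)

lemma map_apply {a b a' b' : ℕ} (ha : a ≤ a') (hb : b ≤ b') (x : S.X a b) :
    ((S.map ha hb).hom.hom x).1 = S.T ha x.1 := rfl

lemma map_self (a b : ℕ) : S.map (le_refl a) (le_refl b) = 𝟙 _ := by
  refine FGModuleCat.hom_ext (LinearMap.ext fun x => Subtype.ext ?_)
  exact S.T_self a x.1

@[simp]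
lemma map_comp {a b a' b' a'' b'' : ℕ} (ha : a ≤ a') (hb : b ≤ b') (ha' : a' ≤ a'')
    (hb' : b' ≤ b'') :
    S.map ha hb ≫ S.map ha' hb' = S.map (ha.trans ha') (hb.trans hb') := by
  refine FGModuleCat.hom_ext (LinearMap.ext fun x => Subtype.ext ?_)
  exact S.T_comp ha ha' x.1

lemma map_square {a b a₁ b₁ a₂ b₂ a' b' : ℕ} (h₁ : a ≤ a₁) (k₁ : b ≤ b₁) (h₁' : a₁ ≤ a')
    (k₁' : b₁ ≤ b') (h₂ : a ≤ a₂) (k₂ : b ≤ b₂) (h₂' : a₂ ≤ a') (k₂' : b₂ ≤ b') :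
    S.map h₁ k₁ ≫ S.map h₁' k₁' = S.map h₂ k₂ ≫ S.map h₂' k₂' := by
  rw [map_comp, map_comp]

/-- The identification of modules of a strip at equal positions. -/
@[simps]
noncomputable def iso {a b a' b' : ℕ} (ha : a = a') (hb : b = b') : S.X a b ≅ S.X a' b' where
  hom := S.map ha.le hb.le
  inv := S.map ha.ge hb.ge
  hom_inv_id := by rw [map_comp, map_self]
  inv_hom_id := by rw [map_comp, map_self]

/-- On this side of the strip the modules are zero; on the other side they are the whole ambient
modules. -/
lemma projective_of_le {a b : ℕ} (h : b ≤ a) : Module.Projective A (S.X a b) := by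
  have h0 : (S.F a).G b = ⊥ := le_bot_iff.1 ((S.F a).bot ▸ (S.F a).mono h)
  change Module.Projective A ((S.F a).G b)
  rw [h0]
  infer_instance

lemma projective_of_ge {a b : ℕ} (h : a + m + 2 ≤ b) : Module.Projective A (S.X a b) := by
  have := (S.F a).projective
  change Module.Projective A ((S.F a).G b)
  rw [(S.F a).top b h]
  exact Module.Projective.of_equiv (Submodule.topEquiv).symm

lemma map_surjective {a b a' : ℕ} (h : a ≤ a') (hb : b ≤ a + m + 2) :
    Function.Surjective (S.map h (le_refl b)).hom.hom := by
  rintro ⟨y, hy⟩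
  rw [← S.map_T h hb] at hy
  obtain ⟨x, hx, rfl⟩ := hy
  exact ⟨⟨x, hx⟩, rfl⟩

lemma map_injective {a b b' : ℕ} (h : b ≤ b') :
    Function.Injective (S.map (le_refl a) h).hom.hom := by
  intro x y hxy
  have := congrArg Subtype.val hxy
  rw [map_apply, map_apply, T_self, T_self] at this
  exact Subtype.ext this

/-- Rectangles in a strip are bicartesian. -/
lemma exists_of_map_eq {a a' b c : ℕ} (ha : a ≤ a') (hb : a' ≤ b) (hbc : b ≤ c)
    (hc : c ≤ a + m + 2) (y : S.X a c) (z : S.X a' b)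
    (h : (S.map ha (le_refl c)).hom.hom y = (S.map (le_refl a') hbc).hom.hom z) :
    ∃ x : S.X a b, (S.map (le_refl a) hbc).hom.hom x = y ∧
      (S.map ha (le_refl b)).hom.hom x = z := by
  obtain ⟨x, rfl⟩ := S.map_surjective ha (hbc.trans hc) z
  have h1 : S.T ha y.1 = S.T ha x.1 := by
    have := congrArg Subtype.val h
    rwa [map_apply, map_apply, map_apply, T_self] at this
  -- The lift x of z is determined up to the kernel G a a', which lies in G a b since a' ≤ b. So y
  -- itself lies in G a b and is the required element.
  have h2 : y.1 - x.1 ∈ (S.F a).G a' := by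
    rw [← S.ker_T ha (hb.trans (hbc.trans hc)), LinearMap.mem_ker, map_sub, h1, sub_self]
  have hy : y.1 ∈ (S.F a).G b := by
    rw [← sub_add_cancel y.1 x.1]
    exact Submodule.add_mem _ ((S.F a).mono hb h2) x.2
  exact ⟨⟨y.1, hy⟩, Subtype.ext (S.T_self a y.1), Subtype.ext h1⟩

/-- Here the projective corner is reached by a surjection, so injectivity comes from the other leg.
The extra indices and equations allow corners whose indices are equal only after arithmetic. -/
lemma isCone_vertical {a b a₁ c₁ a₂ b₂ a₃ c₃ : ℕ} (ha₁ : a₁ = a) (hb₂ : b₂ = b) (ha₃ : a₃ = a₂)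
    (hc₃ : c₃ = c₁) (ha : a ≤ a₂) (hab : a₂ ≤ b) (hbc : b ≤ c₁) (hc : c₁ ≤ a + m + 2)
    (hP : Module.Projective A (S.X a₂ b₂)) :
    IsCone (S.map (a := a) (b := b) ha₁.ge hbc) (S.map ha hb₂.ge)
      (S.map (a' := a₃) (b' := c₃) (ha₁.le.trans (ha.trans ha₃.ge)) hc₃.ge)
      (S.map ha₃.ge (hb₂.le.trans (hbc.trans hc₃.ge))) := by
  subst ha₁ hb₂ ha₃ hc₃
  refine ⟨hP, by simp, fun x hx _ => ?_, fun y z hyz => S.exists_of_map_eq ha hab hbc hc y z hyz,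
    fun y => ?_⟩
  · exact S.map_injective hbc (hx.trans (map_zero _).symm)
  · obtain ⟨w, rfl⟩ := S.map_surjective ha hc y
    exact ⟨w, 0, by rw [map_zero, add_zero]⟩

lemma isCone_horizontal {a b a₁ b₁ a₂ c₂ a₃ c₃ : ℕ} (hb₁ : b₁ = b) (ha₂ : a₂ = a) (ha₃ : a₃ = a₁)
    (hc₃ : c₃ = c₂) (ha : a ≤ a₁) (hab : a₁ ≤ b) (hbc : b ≤ c₂) (hc : c₂ ≤ a + m + 2)
    (hP : Module.Projective A (S.X a₂ c₂)) :
    IsCone (S.map (a := a) (b := b) ha hb₁.ge) (S.map ha₂.ge hbc)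
      (S.map (a' := a₃) (b' := c₃) ha₃.ge (hb₁.le.trans (hbc.trans hc₃.ge)))
      (S.map (ha₂.le.trans (ha.trans ha₃.ge)) hc₃.ge) := by
  subst hb₁ ha₂ ha₃ hc₃
  refine ⟨hP, by simp, fun x _ hx => ?_, fun y z hyz => ?_, fun y => ?_⟩
  · exact S.map_injective hbc (hx.trans (map_zero _).symm)
  · obtain ⟨x, h1, h2⟩ := S.exists_of_map_eq ha hab hbc hc z y hyz.symm
    exact ⟨x, h2, h1⟩
  · obtain ⟨w, rfl⟩ := S.map_surjective ha hc y
    exact ⟨0, w, by rw [map_zero, zero_add]⟩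

lemma isShortExact {a b a₁ c₁ a₂ c₂ : ℕ} (ha₁ : a₁ = a) (hc₂ : c₂ = c₁) (ha₂ : a₂ = b)
    (hab : a ≤ b) (hbc : b ≤ c₁) (hc : c₁ ≤ a + m + 2) :
    IsShortExact (S.map (a := a) (b := b) ha₁.ge hbc)
      (S.map (a' := a₂) (b' := c₂) (ha₁.le.trans (hab.trans ha₂.ge)) hc₂.ge) := by
  subst ha₁ hc₂ ha₂
  refine ⟨S.map_injective hbc, fun y => ⟨fun hy => ?_, ?_⟩, S.map_surjective hab hc⟩
  · obtain ⟨x, hx, -⟩ := S.exists_of_map_eq hab le_rfl hbc hc y 0 (hy.trans (map_zero _).symm)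
    exact ⟨x, hx⟩
  · rintro ⟨x, rfl⟩
    refine Subtype.ext ?_
    have h1 : x.1 ∈ LinearMap.ker (S.T hab) := by
      rw [S.ker_T hab (hbc.trans hc)]
      exact x.2
    rw [map_apply, map_apply, T_self]
    exact h1

/-- A row of a strip. -/
noncomputable def row (a : ℕ) : ComposableArrows (FGModuleCat.{u} A) m where
  obj k := S.X a (a + 1 + k)
  map {k l} f := S.map le_rfl (Nat.add_le_add_left (show k.1 ≤ l.1 from leOfHom f) _)
  map_id _ := S.map_self _ _
  map_comp _ _ := (S.map_comp _ _ _ _).symm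

/-- A column of a strip. -/
noncomputable def column (c : ℕ) : ComposableArrows (FGModuleCat.{u} A) m where
  obj k := S.X (c + k) (c + m + 1)
  map {k l} f := S.map (Nat.add_le_add_left (show k.1 ≤ l.1 from leOfHom f) _) le_rfl
  map_id _ := S.map_self _ _
  map_comp _ _ := (S.map_comp _ _ _ _).symm

/-- The rotation of a row is a column. -/
noncomputable def rotationRow (a : ℕ) : WeakRotation (S.row a) (S.column a) where
  -- These are zero modules: the maps of a row are injective, so their cones are cokernels and no
  -- envelope is needed.
  I k := S.X (a + 1 + k) (a + 1 + k)
  h k := S.map (by lia) le_rfl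
  first := S.iso (a := a) (b := a + 1 + (Fin.last m).1) (a' := a + (0 : Fin (m + 1)).1)
    (b' := a + m + 1) (by simp) (by simp; lia)
  j k := S.map (a' := a + k.succ.1) (b' := a + m + 1) (by simp; lia) (by lia)
  isCone k := by
    have := S.isCone_vertical (a := a) (b := a + 1 + k.1) (a₁ := a + (0 : Fin (m + 1)).1)
      (c₁ := a + m + 1) (a₂ := a + 1 + k.1) (b₂ := a + 1 + k.1) (a₃ := a + k.succ.1)
      (c₃ := a + m + 1) (by simp) rfl (by simp; lia) rfl (by lia) le_rfl (by lia) (by lia)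
      (S.projective_of_le le_rfl)
    have h1 : (S.row a).map (homOfLE (Fin.le_last k.castSucc)) ≫ (S.iso (a := a)
        (b := a + 1 + (Fin.last m).1) (a' := a + (0 : Fin (m + 1)).1)
        (b' := a + m + 1) (by simp) (by simp; lia)).hom = S.map (by simp) (by simp; lia) :=
      S.map_comp le_rfl (by simp) (by simp) (by simp; lia)
    exact (congrArg (fun f => IsCone f _ _ _) h1).mpr this
  e k hk := S.map (by simp) (by simp)
  h_e k hk := S.map_square (by simp; lia) (by simp) (by simp)
    (by simp) (by simp) (by simp) (by simp; lia) (by simp)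
  j_map k hk := S.map_square (by simp; lia) (by simp; lia) (by simp)
    (by simp) (by simp) (by simp) (by simp; lia) (by simp; lia)

/-- The rotation of a column is a row. -/
noncomputable def rotationColumn (c : ℕ) : WeakRotation (S.column c) (S.row (c + m)) where
  -- The maps of a column are surjections, and the whole ambient module in degree c + k serves as
  -- the injective.
  I k := S.X (c + k) (c + k + m + 2)
  h k := S.map le_rfl (by lia)
  first := S.iso (a := c + (Fin.last m).1) (b := c + m + 1) (a' := c + m)
    (b' := c + m + 1 + (0 : Fin (m + 1)).1) (by simp) (by simp)
  j k := S.map (a' := c + m) (b' := c + m + 1 + k.succ.1) (by lia) (by simp; lia)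
  isCone k := by
    have := S.isCone_horizontal (a := c + k.1) (b := c + m + 1) (a₁ := c + m)
      (b₁ := c + m + 1 + (0 : Fin (m + 1)).1) (a₂ := c + k.1) (c₂ := c + k.1 + m + 2)
      (a₃ := c + m) (c₃ := c + m + 1 + k.succ.1) (by simp) rfl rfl (by simp; lia) (by lia)
      (by lia) (by lia) (by lia) (S.projective_of_ge (by lia))
    have h1 : (S.column c).map (homOfLE (Fin.le_last k.castSucc)) ≫ (S.iso
        (a := c + (Fin.last m).1) (b := c + m + 1) (a' := c + m)
        (b' := c + m + 1 + (0 : Fin (m + 1)).1) (by simp) (by simp)).hom =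
        S.map (by simp) (by simp) := S.map_comp (by simp) le_rfl (by simp) (by simp)
    exact (congrArg (fun f => IsCone f _ _ _) h1).mpr this
  e k hk := S.map (by simp) (by simp)
  h_e k hk := S.map_square (by simp) (by simp; lia) (by simp)
    (by simp) (by simp) (by simp) (by simp) (by simp; lia)
  j_map k hk := S.map_square (by simp; lia) (by simp; lia) (by simp)
    (by simp) (by simp) (by simp) (by simp; lia) (by simp; lia)

/-- The cosyzygy of a row is a column. -/
noncomputable def cosyzygyRow (a : ℕ) : WeakCosyzygy (S.row a) (S.column (a + 1)) where
  I := (Functor.const _).obj (S.X a (a + m + 2))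
  h :=
    { app := fun k => S.map le_rfl (by lia)
      naturality := fun k l f => by
        have hkl : k.1 ≤ l.1 := leOfHom f
        exact (S.map_comp le_rfl (by lia) le_rfl (by lia)).trans (Category.comp_id _).symm }
  p :=
    { app := fun k => S.map (a' := a + 1 + k.1) (b' := a + 1 + m + 1) (by lia) (by lia)
      naturality := fun k l f => by
        have hkl : k.1 ≤ l.1 := leOfHom f
        exact (Category.id_comp _).trans (S.map_comp (by lia) (by lia) (by lia) le_rfl).symm }
  projective k := S.projective_of_ge le_rfl
  isShortExact k := S.isShortExact (a := a) (b := a + 1 + k.1) (a₁ := a) (c₁ := a + m + 2)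
    (a₂ := a + 1 + k.1) (c₂ := a + 1 + m + 1) rfl (by lia) rfl (by lia) (by lia) le_rfl

/-- The cosyzygy of a column is a row. -/
noncomputable def cosyzygyColumn (c : ℕ) :
    WeakCosyzygy (S.column c) (S.row (c + m + 1)) where
  I :=
    { obj := fun k => S.X (c + k.1) (c + k.1 + m + 2)
      map := fun {k l} f => S.map (Nat.add_le_add_left (show k.1 ≤ l.1 from leOfHom f) _)
        (by have : k.1 ≤ l.1 := leOfHom f; lia)
      map_id := fun k => S.map_self _ _
      map_comp := fun f g => (S.map_comp _ _ _ _).symm }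
  h :=
    { app := fun k => S.map le_rfl (by lia)
      naturality := fun k l f => by
        have hkl : k.1 ≤ l.1 := leOfHom f
        exact S.map_square (by lia) (by lia) (by lia) (by lia) (by lia) (by lia) (by lia) (by lia) }
  p :=
    { app := fun k => S.map (a' := c + m + 1) (b' := c + m + 1 + 1 + k.1) (by lia) (by lia)
      naturality := fun k l f => by
        have hkl : k.1 ≤ l.1 := leOfHom f
        exact S.map_square (by lia) (by lia) (by lia) (by lia) (by lia) (by lia) (by lia) (by lia) }
  projective k := S.projective_of_ge le_rfl
  isShortExact k := S.isShortExact (a := c + k.1) (b := c + m + 1) (a₁ := c + k.1)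
    (c₁ := c + k.1 + m + 2) (a₂ := c + m + 1) (c₂ := c + m + 1 + 1 + k.1) rfl (by lia) rfl
    (by lia) (by lia) (by lia)

/-- The iterated rotations of the initial row. -/
noncomputable def rotation (k : ℕ) : ComposableArrows (FGModuleCat.{u} A) m :=
  if k % 2 = 0 then S.row (k / 2 * m) else S.column (k / 2 * m)

/-- The iterated cosyzygies of the initial row. -/
noncomputable def cosyzygy (k : ℕ) : ComposableArrows (FGModuleCat.{u} A) m :=
  if k % 2 = 0 then S.row (k / 2 * (m + 2)) else S.column (k / 2 * (m + 2) + 1)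

lemma rotation_zero : S.rotation 0 = S.row 0 := by
  simp [rotation]

lemma cosyzygy_zero : S.cosyzygy 0 = S.row 0 := by
  simp [cosyzygy]

lemma nonempty_weakRotation (k : ℕ) :
    Nonempty (WeakRotation (S.rotation k) (S.rotation (k + 1))) := by
  unfold rotation
  rcases Nat.mod_two_eq_zero_or_one k with h | h
  · rw [if_pos h, if_neg (by lia), show (k + 1) / 2 = k / 2 by lia]
    exact ⟨S.rotationRow _⟩
  · rw [if_neg (by lia), if_pos (by lia), show (k + 1) / 2 = k / 2 + 1 by lia, add_one_mul]
    exact ⟨S.rotationColumn _⟩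

lemma nonempty_weakCosyzygy (k : ℕ) :
    Nonempty (WeakCosyzygy (S.cosyzygy k) (S.cosyzygy (k + 1))) := by
  unfold cosyzygy
  rcases Nat.mod_two_eq_zero_or_one k with h | h
  · rw [if_pos h, if_neg (by lia), show (k + 1) / 2 = k / 2 by lia]
    exact ⟨S.cosyzygyRow _⟩
  · rw [if_neg (by lia), if_pos (by lia), show (k + 1) / 2 = k / 2 + 1 by lia,
      show (k / 2 + 1) * (m + 2) = k / 2 * (m + 2) + 1 + m + 1 by ring]
    exact ⟨S.cosyzygyColumn _⟩

/-- The counts j(m+2) and jm have the same parity, and their halves differ by j. When they are even,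
both row indices are jm(m+2)/2; when they are odd, the + 1 in the column index of the cosyzygy
supplies the remainder of jm modulo 2. -/
lemma rotation_eq_cosyzygy (j : ℕ) : S.rotation (j * (m + 2)) = S.cosyzygy (j * m) := by
  unfold rotation cosyzygy
  have h1 : j * (m + 2) = j * m + 2 * j := by ring
  have h2 : (j * m + 2 * j) / 2 = j * m / 2 + j := by lia
  rcases Nat.mod_two_eq_zero_or_one (j * m) with h | h
  · rw [h1, if_pos (by lia), if_pos h, h2]
    congr 1
    have h3 : j * m = 2 * (j * m / 2) := by lia
    rw [add_mul, mul_add, ← h3.trans (mul_comm _ _)]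
  · rw [h1, if_neg (by lia), if_neg (by lia), h2]
    congr 1
    have h3 : j * m = 2 * (j * m / 2) + 1 := by lia
    rw [add_mul, mul_add, add_assoc, show j * m / 2 * 2 + 1 = j * m by lia]

end Strip

lemma Strip.nonempty_stab_iso_row [IsNoetherianRing A] {m : ℕ} (S : Strip A m)
    {X : ComposableArrows (FGModuleCat.{u} A) m} (t : ∀ k, X.obj k ⟶ (S.F 0).I)
    (ht : ∀ k, Function.Injective (t k).hom.hom)
    (hrange : ∀ k, LinearMap.range (t k).hom.hom = (S.F 0).G (0 + 1 + k.1))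
    (w : ∀ (k : ℕ) (hk : k < m), X.map' k (k + 1) ≫ t ⟨k + 1, by lia⟩ = t ⟨k, by lia⟩) :
    Nonempty (stab X ≅ stab (S.row 0)) := by
  let f : ∀ k, X.obj k ≃ₗ[A] (S.F 0).G (0 + 1 + k.1) := fun k =>
    (LinearEquiv.ofInjective _ (ht k)).trans (LinearEquiv.ofEq _ _ (hrange k))
  refine nonempty_stab_iso_of_app (Y' := S.row 0)
    (fun k => ((f k).toFGModuleCatIso.hom : X.obj k ⟶ _)) (fun k => ?_) fun k hk => ?_
  · have : IsIso ((f k).toFGModuleCatIso.hom) := inferInstance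
    exact Functor.map_isIso (toStable A) ((f k).toFGModuleCatIso.hom)
  · refine congrArg (toStable A).map ?_
    refine FGModuleCat.hom_ext (LinearMap.ext fun x => Subtype.ext ?_)
    have h1 := congrArg (fun g : X.obj ⟨k, by lia⟩ ⟶ (S.F 0).I => g.hom.hom x) (w k hk)
    exact h1.trans (S.T_self 0 _).symm

/-- Every sequence of modules is stably isomorphic to the initial row of a strip. -/
theorem exists_strip (hA : IsFrobenius A) [IsNoetherianRing A] {m : ℕ}
    (X : ComposableArrows (FGModuleCat.{u} A) m) :
    ∃ S : Strip A m, Nonempty (stab X ≅ stab (S.row 0)) := by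
  -- A roof over the identity replaces X by a stably isomorphic sequence of monomorphisms.
  obtain ⟨T, p, -, hp, -, hT⟩ := exists_roof hA (Iso.refl (stab X))
  have e : stab T ≅ stab X :=
    (nonempty_stab_iso_of_app p.app hp fun i hi => by rw [p.naturality]).some
  obtain ⟨I, h, hI⟩ := hA.exists_envelope (T.obj (Fin.last m))
  let t : ∀ k, T.obj k ⟶ I := fun k => T.map (homOfLE (Fin.le_last k)) ≫ h
  have ht_succ : ∀ (k : ℕ) (hk : k < m),
      T.map' k (k + 1) ≫ t ⟨k + 1, by lia⟩ = t ⟨k, by lia⟩ := by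
    intro k hk
    refine (Category.assoc _ _ _).symm.trans (congrArg (· ≫ h) ?_)
    exact (T.map_comp _ _).symm
  have ht : ∀ k, Function.Injective (t k).hom.hom := by
    have H : ∀ (d k : ℕ) (hk : k + d = m), Function.Injective (t ⟨k, by lia⟩).hom.hom := by
      intro d
      induction d with
      | zero =>
        rintro k rfl
        have h1 : t (Fin.last k) = h := by
          change T.map (𝟙 _) ≫ h = h
          rw [T.map_id, Category.id_comp]
        have h2 : Function.Injective (t (Fin.last k)).hom.hom := h1 ▸ hI.injective_hom
        exact h2
      | succ d ih =>
        intro k hk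
        rw [← ht_succ k (by lia)]
        exact (ih (k + 1) (by lia)).comp (hT k (by lia))
    exact fun k => H (m - k.1) k.1 (by lia)
  -- Step b + 1 is the image of position b, so that row 0, which starts in degree 1, is the sequence
  -- T; the whole of I appears from degree m + 2 on.
  let G : ℕ → Submodule A I
    | 0 => ⊥
    | b + 1 => if hb : b ≤ m then LinearMap.range (t ⟨b, by lia⟩).hom.hom else ⊤
  have hG : Monotone G := by
    refine monotone_nat_of_le_succ fun b => ?_
    rcases b with _ | b
    · exact bot_le
    · by_cases hb : b + 1 ≤ m
      · simp only [G, dif_pos hb, dif_pos (show b ≤ m by lia)]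
        rw [← ht_succ b (by lia)]
        rintro _ ⟨x, rfl⟩
        exact ⟨_, rfl⟩
      · simp only [G, dif_neg hb, le_top]
  let F : FilteredModule A m 0 :=
    { I := I, G := G
      projective := (hA.projective_iff I).2 hI.injective_module
      mono := hG
      bot := rfl
      top := fun b hb => by
        obtain ⟨b, rfl⟩ : ∃ c, b = c + 1 := ⟨b - 1, by lia⟩
        simp only [G, dif_neg (show ¬ b ≤ m by lia)] }
  obtain ⟨S, hS⟩ := F.exists_strip hA
  have H : ∃ t : ∀ k, T.obj k ⟶ (S.F 0).I, (∀ k, Function.Injective (t k).hom.hom) ∧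
      (∀ k, LinearMap.range (t k).hom.hom = (S.F 0).G (0 + 1 + k.1)) ∧
      ∀ (k : ℕ) (hk : k < m), T.map' k (k + 1) ≫ t ⟨k + 1, by lia⟩ = t ⟨k, by lia⟩ := by
    rw [hS]
    refine ⟨t, ht, fun k => ?_, ht_succ⟩
    rw [show 0 + 1 + k.1 = k.1 + 1 by lia]
    simp only [F, G, dif_pos (show k.1 ≤ m by lia)]
  obtain ⟨t', h1, h2, h3⟩ := H
  obtain ⟨e'⟩ := S.nonempty_stab_iso_row t' h1 h2 h3
  exact ⟨S, ⟨e.symm ≪≫ e'⟩⟩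

end Strips

/-- A self-injective Artin algebra is Frobenius in the sense above. -/
theorem isFrobenius_of_injective {R : Type w} [CommRing R] [IsArtinianRing R]
    {A : Type u} [Ring A] [Algebra R A] [Module.Finite R A] (hA : Module.Injective A A) :
    IsFrobenius A := by
  have : IsArtinianRing A := IsArtinianRing.of_finite R A
  have hfg : TwoSidedFG A := twoSidedFG_of_algebra (R := R)
  exact ⟨fun P => ⟨injective_of_projective hA P, projective_of_injective hA hfg P⟩,
    exists_isInjectiveEnvelope hA hfg⟩

end StableMor

theorem lemma3p3 {R : Type w} [CommRing R] [IsArtinianRing R]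
    {A : Type u} [Ring A] [Algebra R A] [Module.Finite R A]
    (selfinjective : Module.Injective A A)
    (n : ℕ) (hn : 2 ≤ n) (X : StableMor.Mor n (FGModuleCat.{u} A)) (j : ℕ) (hj : 1 ≤ j) :
    (∃ Y : StableMor.Mor n (StableMor.StableCat A),
      StableMor.IsIterate StableMor.IsRotation (j * (n + 1)) (StableMor.stab X) Y) ∧
    (∃ Z : StableMor.Mor n (StableMor.StableCat A),
      StableMor.IsIterate StableMor.IsCosyzygy (j * (n - 1)) (StableMor.stab X) Z) ∧
    ∀ Y Z : StableMor.Mor n (StableMor.StableCat A),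
      StableMor.IsIterate StableMor.IsRotation (j * (n + 1)) (StableMor.stab X) Y →
      StableMor.IsIterate StableMor.IsCosyzygy (j * (n - 1)) (StableMor.stab X) Z →
      Nonempty (Y ≅ Z) := by
  have : IsArtinianRing A := IsArtinianRing.of_finite R A
  have hA := StableMor.isFrobenius_of_injective (R := R) selfinjective
  -- With m arrows, n + 1 becomes m + 2 and n - 1 becomes m.
  obtain ⟨m, rfl⟩ : ∃ m, n = m + 1 := ⟨n - 1, by lia⟩
  refine ⟨?_, ?_, fun Y Z hY hZ => ?_⟩
  · obtain ⟨Y, hY⟩ := StableMor.exists_isIterate_isRotation hA X (j * (m + 1 + 1))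
    exact ⟨_, hY⟩
  · obtain ⟨Z, hZ⟩ := StableMor.exists_isIterate_isCosyzygy hA X (j * (m + 1 - 1))
    exact ⟨_, hZ⟩
  · obtain ⟨S, e⟩ := StableMor.exists_strip hA X
    obtain ⟨e₁⟩ := StableMor.nonempty_iso_of_isIterate_isRotation hA S.nonempty_weakRotation
      (S.rotation_zero ▸ e) _ hY
    obtain ⟨e₂⟩ := StableMor.nonempty_iso_of_isIterate_isCosyzygy hA S.nonempty_weakCosyzygy
      (S.cosyzygy_zero ▸ e) _ hZ
    have h : StableMor.stab (S.rotation (j * (m + 1 + 1))) =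
        StableMor.stab (S.cosyzygy (j * (m + 1 - 1))) :=
      congrArg StableMor.stab (S.rotation_eq_cosyzygy j)
    exact ⟨e₁ ≪≫ CategoryTheory.eqToIso h ≪≫ e₂.symm⟩
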